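/- **Setting.** Let $\ell_2$ be the Hilbert space of real two-sided square-summable sequences, $\nu>0$, $\lambda>0$, and let $F:\mathbb R\to\mathbb R$ be Lipschitz continuous on bounded sets with $F(0)=0$. For a normed space $\mathfrak B$ let $C(\mathbb R,\mathfrak B)$ carry the compact-open topology and the shift flow $\sigma(h,\mathfrak f)(t)=\mathfrak f(t+h)$, and let $H(\mathfrak f)$ be the closure of $\{\sigma(h,\mathfrak f): h\in\mathbb R\}$. The function $\mathfrak f$ is *Lagrange stable* if $H(\mathfrak f)$ is compact. For subsets $A,B$ of a metric space put $\beta(A,B)=\sup_{a\in A}\inf_{b\in B}d(a,b)$. For $\mathfrak f=(f_i)_{i\in\mathbb Z}\in C(\mathbb R,\ell_2)$ consider, for all $\mathfrak g\in H(\mathfrak f)$, the lattice systems in $\ell_2$ $$u_i'=\nu(u_{i-1}-2u_i+u_{i+1})-\lambda u_i+F(u_i)+g_i(t),\qquad i\in\mathbb Z,\tag{1}$$ and, for $n\in\mathbb N$ and all $\mathfrak g\in H(\mathfrak f^n)$, their $(2n+1)$-dimensional periodic-boundary approximations in Euclidean $\mathbb R^{2n+1}$ $$v_i'=\nu(v_{i-1}-2v_i+v_{i+1})-\lambda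 v_i+F(v_i)+g_i(t),\qquad |i|\le n,\quad v_{-n-1}:=v_n,\ v_{n+1}:=v_{-n}.\tag{2}$$ Here $\mathfrak f^n\in C(\mathbb R,\mathbb R^{2n+1})$ is the truncation $\mathfrak f^n=(f_i)_{|i|\le n}$; alternatively (the result holds for both choices), for all $n$, $\mathfrak f^n_i=f_i$ for $|i|\le n-1$, $\mathfrak f^n_n=f_{-n-1}$, $\mathfrak f^n_{-n}=f_{n+1}$. The space $\mathbb R^{2n+1}$ is embedded isometrically in $\ell_2$ through extension by zero. Let $\varphi:\mathbb R_+\times W\times Y\to W$ be a continuous cocycle over a flow $(Y,\mathbb R,\sigma)$. A set $K\subseteq W$ is called *uniformly attracting* if $\lim_{t\to+\infty}\sup_{y\in Y}\beta(\varphi(t,M,y),K)=0$ for every compact $M\subseteq W$. The *compact global attractor* (Levinson centre) of $\varphi$ is the family $\{I_y\}_{y\in Y}$ given by $$I_y=\bigcap_{t\ge0}\overline{\bigcup_{\tau\ge t}\varphi(\tau,K,\sigma(-\tau,y))},$$ where $K$ is a nonempty compact uniformly attracting set, and such that every $I_y$ is nonempty and compact, $\bigcup_y I_y$ is precompact and uniformly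 attracting, and $\varphi(t,I_y,y)=I_{\sigma(t,y)}$ for all $t\ge 0$, $y\in Y$. **Theorem.** Assume that $F(s)s\le 0$ for all $s\in\mathbb R$ and that $\mathfrak f\in C(\mathbb R,\ell_2)$ is Lagrange stable. Then every Cauchy problem for (1), $\mathfrak g\in H(\mathfrak f)$, and for (2), $\mathfrak g\in H(\mathfrak f^n)$, has exactly one solution on $[0,\infty)$; these solutions define continuous cocycles $\varphi$ over $(H(\mathfrak f),\mathbb R,\sigma)$ with fibre $\ell_2$ and $\varphi_n$ over $(H(\mathfrak f^n),\mathbb R,\sigma)$ with fibre $\mathbb R^{2n+1}$; these cocycles have compact global attractors $\{I_{\mathfrak g}\}_{\mathfrak g\in H(\mathfrak f)}$ and $\{I^n_{\mathfrak g}\}_{\mathfrak g\in H(\mathfrak f^n)}$; and $$\lim_{n\to\infty}\beta\big(I^n_{\mathfrak f^n},I_{\mathfrak f}\big)=0,$$ where $I^n_{\mathfrak f^n}$ is regarded as a subset of $\ell_2$. -/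

import Mathlib

open Filter Topology
open scoped NNReal ENNReal

namespace LatticeAttractor

/-! ### Semi-distance, shifts, hulls -/

/-- Hausdorff semi-distance `β(A, B) = sup_{a ∈ A} inf_{b ∈ B} d(a, b)`, with values in `[0, ∞]`. -/
noncomputable def semiDist {W : Type*} [PseudoEMetricSpace W] (A B : Set W) : ℝ≥0∞ :=
  ⨆ a ∈ A, Metric.infEDist a B

section Shift

variable {B : Type*} [NormedAddCommGroup B]

/-- The shift (Bebutov) dynamical system on `C(ℝ, B)` (compact-open topology):
`σ(h, f)(t) = f(t + h)`. -/
def shiftFlow (B : Type*) [NormedAddCommGroup B] : Flow ℝ C(ℝ, B) where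
  toFun h f := ⟨fun t => f (t + h), by fun_prop⟩
  cont' := by
    refine ContinuousMap.continuous_of_continuous_uncurry _ ?_
    have h1 : Continuous fun p : (ℝ × C(ℝ, B)) × ℝ => (p.1.2, p.2 + p.1.1) := by fun_prop
    exact ContinuousEval.continuous_eval.comp h1
  map_add' s t f := by ext r; exact congrArg f (by ring)
  map_zero' f := by ext r; exact congrArg f (add_zero r)

/-- `H(f)`: the closure in `C(ℝ, B)` of the set of all translates of `f`. -/
def hull (f : C(ℝ, B)) : Set C(ℝ, B) :=
  closure (Set.range fun h : ℝ => shiftFlow B h f)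

/-- `f` is Lagrange stable: the set of its translates is pre-compact in `C(ℝ, B)`. -/
def IsLagrangeStable (f : C(ℝ, B)) : Prop :=
  IsCompact (closure (Set.range fun h : ℝ => shiftFlow B h f))

theorem self_mem_hull (f : C(ℝ, B)) : f ∈ hull f :=
  subset_closure ⟨0, (shiftFlow B).map_zero' f⟩

theorem hull_isInvariant (f : C(ℝ, B)) : IsInvariant (shiftFlow B) (hull f) := by
  intro t
  refine Set.MapsTo.closure ?_ ((shiftFlow B).continuous continuous_const continuous_id)
  rintro _ ⟨h, rfl⟩
  exact ⟨t + h, (shiftFlow B).map_add' t h f⟩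

/-- The shift dynamical system on `H(f)`. -/
def hullFlow (f : C(ℝ, B)) : Flow ℝ (hull f) :=
  (shiftFlow B).restrict (hull_isInvariant f)

/-- `f` as a point of its own hull. -/
def hullPoint (f : C(ℝ, B)) : hull f := ⟨f, self_mem_hull f⟩

end Shift

/-! ### Cocycles and their compact global attractors -/

/-- A cocycle with fibre `W` over the two-sided dynamical system `(Y, ℝ, σ)`. -/
structure Cocycle {Y : Type*} [TopologicalSpace Y] (σ : Flow ℝ Y)
    (W : Type*) [TopologicalSpace W] where
  toFun : ℝ≥0 → W → Y → W
  continuous_toFun : Continuous fun p : ℝ≥0 × W × Y => toFun p.1 p.2.1 p.2.2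
  map_zero : ∀ u y, toFun 0 u y = u
  map_add : ∀ (t τ : ℝ≥0) u y, toFun (t + τ) u y = toFun τ (toFun t u y) (σ t y)

namespace Cocycle

variable {Y : Type*} [TopologicalSpace Y] {σ : Flow ℝ Y} {W : Type*} [MetricSpace W]

/-- `φ(t, M, y)`. -/
def image (φ : Cocycle σ W) (t : ℝ≥0) (M : Set W) (y : Y) : Set W :=
  (fun u => φ.toFun t u y) '' M

/-- `lim_{t → +∞} sup_{y ∈ Y} β(φ(t, M, y), K) = 0` for every compact `M`. -/
def UniformlyAttracts (φ : Cocycle σ W) (K : Set W) : Prop :=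
  ∀ M : Set W, IsCompact M →
    Tendsto (fun t : ℝ≥0 => ⨆ y : Y, semiDist (φ.image t M y) K) atTop (𝓝 0)

/-- `ω_y(K) = ⋂_{t ≥ 0} closure (⋃_{τ ≥ t} φ(τ, K, σ(-τ, y)))`. -/
def pullbackOmega (φ : Cocycle σ W) (K : Set W) (y : Y) : Set W :=
  ⋂ t : ℝ≥0, closure (⋃ (τ : ℝ≥0) (_ : t ≤ τ), φ.image τ K (σ (-(τ : ℝ)) y))

/-- The family `I` is the compact global attractor (Levinson centre) of `φ`. The field `levinson`
also says that `φ` is uniformly compactly dissipative, and it pins the fibres down. -/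
structure IsCompactGlobalAttractor (φ : Cocycle σ W) (I : Y → Set W) : Prop where
  nonempty : ∀ y, (I y).Nonempty
  isCompact : ∀ y, IsCompact (I y)
  precompact : IsCompact (closure (⋃ y, I y))
  invariant : ∀ (t : ℝ≥0) y, φ.image t (I y) y = I (σ t y)
  attracts : φ.UniformlyAttracts (⋃ y, I y)
  levinson : ∃ K : Set W, K.Nonempty ∧ IsCompact K ∧ φ.UniformlyAttracts K ∧
    ∀ y, I y = φ.pullbackOmega K y

/-- `φ` is the cocycle of solutions of a family of Cauchy problems indexed by `g ∈ H(f)`, where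
`S g v u` says that `u` solves on `[0, ∞)` the problem with forcing `g` and `u(0) = v`: every
problem has exactly one solution on `[0, ∞)`, namely `t ↦ φ(t, v, g)`. -/
def IsGeneratedBy {B : Type*} [NormedAddCommGroup B] {f : C(ℝ, B)}
    (φ : Cocycle (hullFlow f) B) (S : C(ℝ, B) → B → (ℝ → B) → Prop) : Prop :=
  ∀ (g : hull f) (v : B) (u : ℝ → B), S g v u ↔ ∀ t : ℝ≥0, u t = φ.toFun t v g

end Cocycle

/-! ### The lattice system and its finite-dimensional approximations -/

/-- The Hilbert space `ℓ₂` of real two-sided square-summable sequences. -/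
abbrev EllTwo : Type := lp (fun _ : ℤ => ℝ) 2

/-- `ℝ^{2n+1}` with the Euclidean norm. The position `j = 0, …, 2n` carries the lattice site
`site n j = j - n`. Addition on `Fin (2n+1)` is cyclic. -/
abbrev Space (n : ℕ) : Type := EuclideanSpace ℝ (Fin (2 * n + 1))

/-- The lattice site `j - n ∈ {-n, …, n}` at the position `j`. -/
def site (n : ℕ) (j : Fin (2 * n + 1)) : ℤ := (j : ℤ) - n

/-- The lattice index sampled at position `j` when the two boundary entries of the forcing are
`f_{-n-1}` at the site `n` and `f_{n+1}` at the site `-n`. -/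
def swappedSite (n : ℕ) (j : Fin (2 * n + 1)) : ℤ :=
  if site n j = n then -n - 1 else if site n j = -n then n + 1 else site n j

/-- `u` solves `u_i' = ν (u_{i-1} - 2 u_i + u_{i+1}) - λ u_i + F(u_i) + g_i(t)`, `i ∈ ℤ`, in `ℓ₂` on
`[0, ∞)` with `u(0) = v` (the derivative is that of an `ℓ₂`-valued function, one-sided at `0`). -/
def IsLatticeSolution (ν lam : ℝ) (F : ℝ → ℝ) (g : C(ℝ, EllTwo)) (v : EllTwo)
    (u : ℝ → EllTwo) : Prop :=
  u 0 = v ∧ ∀ t : ℝ, 0 ≤ t → ∃ w : EllTwo, HasDerivWithinAt u w (Set.Ici 0) t ∧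
    ∀ i : ℤ, w i = ν * (u t (i - 1) - 2 * u t i + u t (i + 1)) - lam * u t i + F (u t i) + g t i

/-- `v` solves the `(2n+1)`-dimensional system with periodic boundary conditions on `[0, ∞)`,
with `v(0) = v₀`. -/
def IsApproxSolution (ν lam : ℝ) (F : ℝ → ℝ) (n : ℕ) (g : C(ℝ, Space n)) (v₀ : Space n)
    (v : ℝ → Space n) : Prop :=
  v 0 = v₀ ∧ ∀ t : ℝ, 0 ≤ t → ∃ w : Space n, HasDerivWithinAt v w (Set.Ici 0) t ∧
    ∀ j : Fin (2 * n + 1),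
      w j = ν * (v t (j - 1) - 2 * v t j + v t (j + 1)) - lam * v t j + F (v t j) + g t j

/-- The forcing `𝔣ⁿ ∈ C(ℝ, ℝ^{2n+1})` whose entry at the position `j` is the coordinate `f_{idx j}`
of `f`; `idx = site n` gives the truncation `(f_i)_{|i| ≤ n}`. -/
noncomputable def approxForcing (n : ℕ) (idx : Fin (2 * n + 1) → ℤ) (f : C(ℝ, EllTwo)) :
    C(ℝ, Space n) where
  toFun t := WithLp.toLp 2 fun j => f t (idx j)
  continuous_toFun := by
    refine (PiLp.continuous_toLp 2 _).comp (continuous_pi fun j => ?_)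
    exact ((lp.lipschitzWith_one_eval 2 (idx j)).continuous).comp f.continuous

/-- The isometric embedding `ℝ^{2n+1} → ℓ₂`, extension by zero:
`(…, 0, v_{-n}, …, v_n, 0, …)`. -/
noncomputable def embed (n : ℕ) (v : Space n) : EllTwo :=
  ∑ j : Fin (2 * n + 1), lp.single 2 (site n j) (v j)

end LatticeAttractor

open LatticeAttractor

namespace LatticeAttractor

open Set Metric

/-! Everything is carried out in ℓ₂. Extension by zero is an isometry that turns the periodic system
into a lattice system in which the shift i ↦ i + 1 is replaced by `cyclicShift n`, cyclic on |i| ≤ n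
and the identity outside. A single field `latticeField`, with a permutation as parameter, therefore
covers the infinite and all the finite systems, and its estimates are uniform over permutations that
change |i| by at most 1.

The inequality ⟪N x, x⟫ ≤ -lam ‖x‖² gives global solutions and an absorbing ball. Compactness comes
from the tails. The equation is paired with θ_i u_i, where θ is a cut-off in |i| at scale k.
Summation by parts shows that the discrete Laplacian costs only O(1/k), the Lipschitz constant of θ;
the sign of F makes the nonlinear term nonpositive; and the forcing takes values in a compact set,
so its tails are uniformly small (`inner_latticeField_weight_le`, `energy_le_of_isSolution`,
`exists_tailEnergy_bound`). Hence one compact set `absorbingSet`, independent of n, attracts the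
lattice cocycle and contains every embedded finite-dimensional attractor (`embed_mem_absorbingSet`).
Abstract theory over a compact base then yields the Levinson centre.

For the convergence, let p be a limit of embedded points of the finite attractors. For each s these
points end trajectories that start at time -s inside the finite attractors. The starting points
accumulate in `absorbingSet`, and solutions of the finite systems converge to solutions of the
lattice system (`tendsto_embed_solution`), so p is reached from `absorbingSet` over every past time
s. Such a point lies in the Levinson centre (`Cocycle.mem_pullbackOmega_of_forall_mem_image`). -/

/-! ### Dissipative evolution equations in a Hilbert space -/

section Cutoff

variable {E : Type*} [NormedAddCommGroup E]

/-- The cut-off `min(1, (R + 1 - ‖x‖)⁺)`. -/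
noncomputable def cutoff (R : ℝ) (x : E) : ℝ := max 0 (min 1 (R + 1 - ‖x‖))

theorem cutoff_nonneg (R : ℝ) (x : E) : 0 ≤ cutoff R x := le_max_left _ _

theorem cutoff_le_one (R : ℝ) (x : E) : cutoff R x ≤ 1 := max_le zero_le_one (min_le_left _ _)

theorem cutoff_eq_one {R : ℝ} {x : E} (hx : ‖x‖ ≤ R) : cutoff R x = 1 := by
  rw [cutoff, min_eq_left (by linarith), max_eq_right zero_le_one]

theorem cutoff_eq_zero {R : ℝ} {x : E} (hx : R + 1 ≤ ‖x‖) : cutoff R x = 0 := by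
  rw [cutoff, min_eq_right (by linarith), max_eq_left (by linarith)]

theorem abs_cutoff_sub_le (R : ℝ) (x y : E) : |cutoff R x - cutoff R y| ≤ ‖x - y‖ := by
  have h1 : |cutoff R x - cutoff R y| ≤ |min 1 (R + 1 - ‖x‖) - min 1 (R + 1 - ‖y‖)| :=
    by
    simpa only [cutoff, max_comm] using
      abs_max_sub_max_le_abs (min 1 (R + 1 - ‖x‖)) (min 1 (R + 1 - ‖y‖)) 0
  refine h1.trans ((abs_min_sub_min_le_max _ _ _ _).trans ?_)
  rw [sub_self, abs_zero, max_eq_right (abs_nonneg _), sub_sub_sub_cancel_left, abs_sub_comm]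
  exact abs_norm_sub_norm_le x y

end Cutoff

/-! ### A priori bounds, uniqueness and global existence. -/

section ODE

variable {E : Type*} [NormedAddCommGroup E] [InnerProductSpace ℝ E]

/-- A vector field that is Lipschitz on bounded sets and satisfies `⟪N x, x⟫ ≤ -lam ‖x‖²`. -/
structure Dissipative (N : E → E) (lam : ℝ) : Prop where
  lipschitz : ∀ R : ℝ, ∃ L : ℝ≥0, LipschitzOnWith L N (closedBall 0 R)
  inner_le : ∀ x, inner ℝ (N x) x ≤ -lam * ‖x‖ ^ 2

/-- `u` solves `u' = N u + g(t)`, `u(0) = v` on `[0, ∞)`. -/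
def IsSolution (N : E → E) (g : C(ℝ, E)) (v : E) (u : ℝ → E) : Prop :=
  u 0 = v ∧ ∀ t : ℝ, 0 ≤ t → HasDerivWithinAt u (N (u t) + g t) (Ici 0) t

/-- Grönwall's inequality for `w' ≤ -lam w + c`. -/
theorem le_exp_mul_add_of_deriv_le {w w' : ℝ → ℝ} {lam c : ℝ} (hlam : 0 < lam) (hc : 0 ≤ c)
    (hw : ∀ t, 0 ≤ t → HasDerivWithinAt w (w' t) (Ici 0) t)
    (hb : ∀ t, 0 ≤ t → w' t ≤ -lam * w t + c) {t : ℝ} (ht : 0 ≤ t) :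
    w t ≤ Real.exp (-lam * t) * w 0 + c / lam := by
  have h := le_gronwallBound_of_liminf_deriv_right_le (f := w) (f' := w') (δ := w 0) (K := -lam)
    (ε := c) (a := 0) (b := t)
    (fun s hs => ((hw s hs.1).continuousWithinAt).mono Icc_subset_Ici_self)
    (fun s hs r hr => ((hw s hs.1).mono (Ici_subset_Ici.2 hs.1)).liminf_right_slope_le hr)
    le_rfl (fun s hs => hb s hs.1) t ⟨ht, le_rfl⟩
  rw [gronwallBound_of_K_ne_0 (by linarith)] at h
  beta_reduce at h
  have h1 : c / -lam * (Real.exp (-lam * (t - 0)) - 1) =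
      c / lam - c / lam * Real.exp (-lam * (t - 0)) := by
    rw [div_neg]; ring
  rw [h1, sub_zero] at h
  have h2 : 0 ≤ c / lam * Real.exp (-lam * t) := by positivity
  linarith

/-- By Young's inequality half of the damping absorbs the forcing; the other half remains as the
decay rate of ‖u‖². -/
theorem two_inner_le_of_dissipative {N : E → E} {lam : ℝ} (hN : Dissipative N lam) (hlam : 0 < lam)
    {x g : E} {C : ℝ} (hg : ‖g‖ ≤ C) :
    2 * inner ℝ x (N x + g) ≤ -lam * ‖x‖ ^ 2 + C ^ 2 / lam := by
  have h1 := hN.inner_le x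
  have h2 : inner ℝ x g ≤ ‖x‖ * C :=
    (real_inner_le_norm x g).trans (mul_le_mul_of_nonneg_left hg (norm_nonneg x))
  rw [inner_add_right, real_inner_comm]
  have h3 : 2 * (‖x‖ * C) ≤ lam * ‖x‖ ^ 2 + C ^ 2 / lam := by
    have h4 : 0 ≤ (lam * ‖x‖ - C) ^ 2 / lam := by positivity
    have h5 : (lam * ‖x‖ - C) ^ 2 / lam = lam * ‖x‖ ^ 2 + C ^ 2 / lam - 2 * (‖x‖ * C) := by
      field_simp
      ring
    linarith
  linarith

theorem IsSolution.norm_sq_le {N : E → E} {lam : ℝ} (hN : Dissipative N lam) (hlam : 0 < lam)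
    {g : C(ℝ, E)} {C : ℝ} (hg : ∀ t, ‖g t‖ ≤ C) {v : E} {u : ℝ → E} (hu : IsSolution N g v u)
    {t : ℝ} (ht : 0 ≤ t) :
    ‖u t‖ ^ 2 ≤ Real.exp (-lam * t) * ‖v‖ ^ 2 + C ^ 2 / lam ^ 2 := by
  have h := le_exp_mul_add_of_deriv_le (w := fun t => ‖u t‖ ^ 2) hlam
    (c := C ^ 2 / lam) (by positivity) (fun s hs => (hu.2 s hs).norm_sq)
    (fun s _ => two_inner_le_of_dissipative hN hlam (hg s)) ht
  rw [hu.1, div_div, ← sq] at h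
  exact h

theorem IsSolution.norm_le {N : E → E} {lam : ℝ} (hN : Dissipative N lam) (hlam : 0 < lam)
    {g : C(ℝ, E)} {C : ℝ} (hC : 0 ≤ C) (hg : ∀ t, ‖g t‖ ≤ C) {v : E} {u : ℝ → E}
    (hu : IsSolution N g v u) {t : ℝ} (ht : 0 ≤ t) : ‖u t‖ ≤ ‖v‖ + C / lam := by
  have h := hu.norm_sq_le hN hlam hg ht
  have h1 : Real.exp (-lam * t) ≤ 1 := Real.exp_le_one_iff.2 (by nlinarith)
  refine abs_le_of_sq_le_sq' ?_ (by positivity) |>.2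
  have h2 : Real.exp (-lam * t) * ‖v‖ ^ 2 ≤ 1 * ‖v‖ ^ 2 :=
    mul_le_mul_of_nonneg_right h1 (sq_nonneg _)
  have h3 : 0 ≤ ‖v‖ * (C / lam) := by positivity
  have h4 : (C / lam) ^ 2 = C ^ 2 / lam ^ 2 := div_pow _ _ _
  nlinarith

/-- Continuous dependence: an exact and an `ε`-approximate solution inside a ball. -/
theorem dist_le_of_approx_solution {N : E → E} {R T ε : ℝ} {L : ℝ≥0}
    (hL : LipschitzOnWith L N (closedBall 0 R)) {g : ℝ → E} {u w w' : ℝ → E} (hε : 0 ≤ ε)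
    (hu : ∀ t ∈ Icc 0 T, HasDerivWithinAt u (N (u t) + g t) (Icc 0 T) t)
    (huR : ∀ t ∈ Icc 0 T, ‖u t‖ ≤ R)
    (hw : ∀ t ∈ Icc 0 T, HasDerivWithinAt w (w' t) (Icc 0 T) t)
    (hwR : ∀ t ∈ Icc 0 T, ‖w t‖ ≤ R)
    (hww : ∀ t ∈ Icc 0 T, dist (w' t) (N (w t) + g t) ≤ ε) :
    ∀ t ∈ Icc 0 T, dist (u t) (w t) ≤ (dist (u 0) (w 0) + ε) * Real.exp ((L + 1) * t) := by
  have hIci : ∀ {y : ℝ → E} {y' : E} {t : ℝ}, t ∈ Ico 0 T →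
      HasDerivWithinAt y y' (Icc 0 T) t → HasDerivWithinAt y y' (Ici t) t := fun {y y' t} ht h =>
    h.mono_of_mem_nhdsWithin (mem_of_superset (Icc_mem_nhdsGE ht.2)
      (Icc_subset_Icc_left ht.1))
  intro t ht
  have h := dist_le_of_approx_trajectories_ODE_of_mem (v := fun t x => N x + g t)
    (s := fun _ => closedBall 0 R) (K := L + 1) (f := u) (g := w) (a := 0) (b := T) (εf := 0)
    (εg := ε) (f' := fun t => N (u t) + g t) (g' := w') (δ := dist (u 0) (w 0))
    (fun t _ => LipschitzOnWith.of_dist_le_mul fun x hx y hy => by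
      rw [dist_add_right]
      refine (hL.dist_le_mul x hx y hy).trans ?_
      push_cast
      nlinarith [dist_nonneg (x := x) (y := y)])
    (fun t ht => (hu t ht).continuousWithinAt)
    (fun t ht => hIci ht (hu t (Ico_subset_Icc_self ht)))
    (fun t _ => (dist_self _).le)
    (fun t ht => mem_closedBall_zero_iff.2 (huR t (Ico_subset_Icc_self ht)))
    (fun t ht => (hw t ht).continuousWithinAt)
    (fun t ht => hIci ht (hw t (Ico_subset_Icc_self ht)))
    (fun t ht => hww t (Ico_subset_Icc_self ht))
    (fun t ht => mem_closedBall_zero_iff.2 (hwR t (Ico_subset_Icc_self ht)))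
    le_rfl t ht
  refine h.trans ?_
  have hL0 : (0 : ℝ) < L + 1 := by positivity
  rw [gronwallBound_of_K_ne_0 (by push_cast; exact hL0.ne')]
  push_cast
  rw [zero_add, sub_zero, add_mul (dist (u 0) (w 0))]
  refine add_le_add le_rfl ?_
  have h1 : 1 ≤ Real.exp ((L + 1) * t) := Real.one_le_exp (mul_nonneg hL0.le ht.1)
  have h2 : ε / (L + 1) ≤ ε := div_le_self hε (by simp)
  calc ε / (L + 1) * (Real.exp ((L + 1) * t) - 1) ≤ ε * (Real.exp ((L + 1) * t) - 1) :=
        mul_le_mul_of_nonneg_right h2 (by linarith)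
    _ ≤ ε * Real.exp ((L + 1) * t) := by nlinarith

/-- Uniqueness on compact intervals. -/
theorem eqOn_of_solutions {N : E → E} {lam : ℝ} (hN : Dissipative N lam) {T : ℝ} {g : ℝ → E}
    {u w : ℝ → E} (hu : ∀ t ∈ Icc 0 T, HasDerivWithinAt u (N (u t) + g t) (Icc 0 T) t)
    (hw : ∀ t ∈ Icc 0 T, HasDerivWithinAt w (N (w t) + g t) (Icc 0 T) t) (h0 : u 0 = w 0) :
    EqOn u w (Icc 0 T) := by
  obtain ⟨R₁, hR₁⟩ := (isCompact_Icc (a := (0 : ℝ)) (b := T)).exists_bound_of_continuousOn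
    (f := u) (fun t ht => (hu t ht).continuousWithinAt)
  obtain ⟨R₂, hR₂⟩ := (isCompact_Icc (a := (0 : ℝ)) (b := T)).exists_bound_of_continuousOn
    (f := w) (fun t ht => (hw t ht).continuousWithinAt)
  obtain ⟨L, hL⟩ := hN.lipschitz (max R₁ R₂)
  intro t ht
  have h := dist_le_of_approx_solution hL le_rfl hu (fun t ht => (hR₁ t ht).trans (le_max_left _ _))
    hw (fun t ht => (hR₂ t ht).trans (le_max_right _ _)) (fun t _ => (dist_self _).le) t ht
  rw [h0, dist_self, zero_add, zero_mul] at h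
  exact dist_le_zero.1 h

theorem IsSolution.hasDerivWithinAt_Icc {N : E → E} {g : C(ℝ, E)} {v : E} {u : ℝ → E}
    (hu : IsSolution N g v u) (T : ℝ) :
    ∀ t ∈ Icc 0 T, HasDerivWithinAt u (N (u t) + g t) (Icc 0 T) t :=
  fun t ht => (hu.2 t ht.1).mono Icc_subset_Ici_self

theorem IsSolution.unique {N : E → E} {lam : ℝ} (hN : Dissipative N lam) {g : C(ℝ, E)} {v : E}
    {u w : ℝ → E} (hu : IsSolution N g v u) (hw : IsSolution N g v w) {t : ℝ} (ht : 0 ≤ t) :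
    u t = w t :=
  eqOn_of_solutions hN (hu.hasDerivWithinAt_Icc t) (hw.hasDerivWithinAt_Icc t)
    (hu.1.trans hw.1.symm) ⟨ht, le_rfl⟩

/-- The cut-off makes the speed at most M everywhere, so a curve cannot leave the ball of radius a =
M T about v within time T, and Picard–Lindelöf applies on the whole of [0, T] however large T is.
The Lipschitz constant is L₂ + B: the cut-off is itself 1-Lipschitz, and B bounds the field it
multiplies on that ball. -/
theorem exists_cutoff_solution [CompleteSpace E] {N : E → E} {lam : ℝ} (hN : Dissipative N lam)
    (g : C(ℝ, E)) {C : ℝ} (hC : 0 ≤ C) (hg : ∀ t, ‖g t‖ ≤ C) (v : E) {T R : ℝ} (hT : 0 ≤ T)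
    (hR : 0 ≤ R) :
    ∃ u : ℝ → E, u 0 = v ∧ ∀ t ∈ Icc 0 T,
      HasDerivWithinAt u (cutoff R (u t) • (N (u t) + g t)) (Icc 0 T) t := by
  obtain ⟨L₁, hL₁⟩ := hN.lipschitz (R + 1)
  have hbound : ∀ {ρ : ℝ} {L : ℝ≥0}, LipschitzOnWith L N (closedBall 0 ρ) → 0 ≤ ρ →
      ∀ x : E, ‖x‖ ≤ ρ → ∀ t, ‖N x + g t‖ ≤ ‖N 0‖ + L * ρ + C := by
    intro ρ L hL hρ x hx t
    have h := hL.dist_le_mul x (mem_closedBall_zero_iff.2 hx) 0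
      (mem_closedBall_zero_iff.2 (by simpa using hρ))
    rw [dist_eq_norm, dist_zero_right] at h
    have h1 : ‖N x‖ ≤ ‖N 0‖ + ‖N x - N 0‖ := by
      simpa using norm_add_le (N 0) (N x - N 0)
    have h2 : (L : ℝ) * ‖x‖ ≤ L * ρ := by gcongr
    linarith [norm_add_le (N x) (g t), hg t]
  let M : ℝ≥0 := ⟨‖N 0‖ + L₁ * (R + 1) + C, by positivity⟩
  let a : ℝ≥0 := M * ⟨T, hT⟩
  obtain ⟨L₂, hL₂⟩ := hN.lipschitz (‖v‖ + a)
  let B : ℝ≥0 := ⟨‖N 0‖ + L₂ * (‖v‖ + a) + C, by positivity⟩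
  have hball : ∀ x ∈ closedBall v a, ‖x‖ ≤ ‖v‖ + a := fun x hx => by
    have := norm_le_norm_add_norm_sub' x v
    rw [mem_closedBall, dist_eq_norm] at hx
    linarith
  have hPL : IsPicardLindelof (fun t x => cutoff R x • (N x + g t)) (tmin := 0) (tmax := T)
      ⟨0, le_rfl, hT⟩ v a 0 M (L₂ + B) := by
    refine ⟨fun t _ => LipschitzOnWith.of_dist_le_mul fun x hx y hy => ?_, fun x _ => ?_,
      fun t _ x _ => ?_, ?_⟩
    · have hx' := hball x hx
      have hy' := hball y hy
      have h1 : cutoff R x • (N x + g t) - cutoff R y • (N y + g t) =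
          cutoff R x • (N x - N y) + (cutoff R x - cutoff R y) • (N y + g t) := by
        rw [smul_add, smul_add, smul_sub, sub_smul, smul_add, smul_add]; abel
      have h2 := hL₂.dist_le_mul x (mem_closedBall_zero_iff.2 hx') y (mem_closedBall_zero_iff.2 hy')
      have h3 : ‖N y + g t‖ ≤ B := hbound hL₂ (by positivity) y hy' t
      rw [dist_eq_norm, dist_eq_norm] at *
      rw [h1]
      refine (norm_add_le _ _).trans ?_
      rw [norm_smul, norm_smul, Real.norm_eq_abs, Real.norm_eq_abs, abs_of_nonneg (cutoff_nonneg R x)]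
      have h4 : cutoff R x * ‖N x - N y‖ ≤ 1 * ‖N x - N y‖ :=
        mul_le_mul_of_nonneg_right (cutoff_le_one R x) (norm_nonneg _)
      have h5 := mul_le_mul (abs_cutoff_sub_le R x y) h3 (norm_nonneg _) (norm_nonneg _)
      push_cast
      linarith
    · fun_prop
    · rw [norm_smul, Real.norm_eq_abs, abs_of_nonneg (cutoff_nonneg R x)]
      by_cases hx : ‖x‖ ≤ R + 1
      · have h3 : ‖N x + g t‖ ≤ M := hbound hL₁ (by positivity) x hx t
        have h4 := mul_le_mul_of_nonneg_right (cutoff_le_one R x) (norm_nonneg (N x + g t))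
        linarith
      · rw [cutoff_eq_zero (not_le.1 hx).le, zero_mul]
        exact M.2
    · have ha : (a : ℝ) = M * T := rfl
      simp [hT, ha]
  exact hPL.exists_eq_forall_mem_Icc_hasDerivWithinAt₀

/-- With R > C / lam, the derivative of ‖u‖² on the sphere ‖u‖ = R is at most 2 R (C - lam R) < 0,
so the sphere is never crossed outwards and the cut-off stays equal to 1. -/
theorem exists_solution_Icc [CompleteSpace E] {N : E → E} {lam : ℝ} (hN : Dissipative N lam)
    (hlam : 0 < lam) (g : C(ℝ, E)) {C : ℝ} (hg : ∀ t, ‖g t‖ ≤ C) (v : E) {T : ℝ} (hT : 0 ≤ T) :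
    ∃ u : ℝ → E, u 0 = v ∧ ∀ t ∈ Icc 0 T, HasDerivWithinAt u (N (u t) + g t) (Icc 0 T) t := by
  have hC : 0 ≤ C := (norm_nonneg _).trans (hg 0)
  have hCl : 0 ≤ C / lam := by positivity
  obtain ⟨R, hR0, hR1, hR2⟩ : ∃ R : ℝ, 0 < R ∧ ‖v‖ ≤ R ∧ C / lam < R :=
    ⟨‖v‖ + C / lam + 1, by positivity, by linarith, by linarith [norm_nonneg v]⟩
  obtain ⟨u, hu0, hu⟩ := exists_cutoff_solution hN g hC hg v hT hR0.le
  have hle : ∀ t ∈ Icc 0 T, ‖u t‖ ≤ R := by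
    intro t ht
    have h := image_le_of_deriv_right_lt_deriv_boundary' (f := fun t => ‖u t‖ ^ 2)
      (f' := fun t => 2 * inner ℝ (u t) (cutoff R (u t) • (N (u t) + g t)))
      (B := fun _ => R ^ 2) (B' := fun _ => 0) (a := 0) (b := T)
      (fun s hs => (hu s hs).norm_sq.continuousWithinAt)
      (fun s hs => (hu s (Ico_subset_Icc_self hs)).norm_sq.mono_of_mem_nhdsWithin
        (mem_of_superset (Icc_mem_nhdsGE hs.2) (Icc_subset_Icc_left hs.1)))
      (by simp only [hu0]; gcongr) continuousOn_const
      (fun s _ => hasDerivWithinAt_const _ _ _)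
      (fun s _ hs => by
        have hs' : ‖u s‖ = R := (sq_eq_sq₀ (norm_nonneg _) hR0.le).1 hs
        rw [cutoff_eq_one hs'.le, one_smul, inner_add_right, real_inner_comm]
        have h1 := hN.inner_le (u s)
        have h2 : inner ℝ (u s) (g s) ≤ R * C :=
          (real_inner_le_norm _ _).trans (by rw [hs']; gcongr; exact hg s)
        rw [hs'] at h1
        have h3 : C < R * lam := (div_lt_iff₀ hlam).1 hR2
        nlinarith)
    exact abs_le_of_sq_le_sq' (h ht) hR0.le |>.2
  refine ⟨u, hu0, fun t ht => ?_⟩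
  have h := hu t ht
  rwa [cutoff_eq_one (hle t ht), one_smul] at h

theorem exists_solution [CompleteSpace E] {N : E → E} {lam : ℝ} (hN : Dissipative N lam)
    (hlam : 0 < lam) (g : C(ℝ, E)) {C : ℝ} (hg : ∀ t, ‖g t‖ ≤ C) (v : E) :
    ∃ u : ℝ → E, IsSolution N g v u := by
  have hex : ∀ T : ℝ, ∃ u : ℝ → E, 0 ≤ T → u 0 = v ∧
      ∀ t ∈ Icc 0 T, HasDerivWithinAt u (N (u t) + g t) (Icc 0 T) t := fun T => by
    by_cases hT : 0 ≤ T
    · obtain ⟨u, hu⟩ := exists_solution_Icc hN hlam g hg v hT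
      exact ⟨u, fun _ => hu⟩
    · exact ⟨0, fun h => absurd h hT⟩
  choose U hU using hex
  have hEq : ∀ S T : ℝ, 0 ≤ S → S ≤ T → EqOn (U S) (U T) (Icc 0 S) := fun S T hS hST =>
    eqOn_of_solutions hN (hU S hS).2
      (fun t ht => ((hU T (hS.trans hST)).2 t ⟨ht.1, ht.2.trans hST⟩).mono
        (Icc_subset_Icc_right hST))
      ((hU S hS).1.trans (hU T (hS.trans hST)).1.symm)
  -- The solution used at time t has horizon t + 1, so its interval contains a full neighbourhood of
  -- t in [0, ∞); by uniqueness the choice of horizon does not matter there.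
  refine ⟨fun t => U (t + 1) t, (hU (0 + 1) (by norm_num)).1, fun t ht => ?_⟩
  have hT : t < t + 1 := by linarith
  have hmem : Icc 0 (t + 1) ∈ 𝓝[Ici 0] t := by
    filter_upwards [self_mem_nhdsWithin, mem_nhdsWithin_of_mem_nhds (Iio_mem_nhds hT)]
      with s hs hs' using ⟨hs, le_of_lt hs'⟩
  have h : HasDerivWithinAt (U (t + 1)) (N (U (t + 1) t) + g t) (Ici 0) t :=
    ((hU (t + 1) (by linarith)).2 t ⟨ht, hT.le⟩).mono_of_mem_nhdsWithin hmem
  have hEv : (fun t => U (t + 1) t) =ᶠ[𝓝[Ici 0] t] U (t + 1) := by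
    filter_upwards [self_mem_nhdsWithin, mem_nhdsWithin_of_mem_nhds (Iio_mem_nhds hT)]
      with s hs0 hs
    have hs0 : (0 : ℝ) ≤ s := hs0
    rcases le_total (s + 1) (t + 1) with hst | hst
    · exact hEq _ _ (by linarith) hst ⟨hs0, by linarith⟩
    · exact (hEq _ _ (by linarith) hst ⟨hs0, le_of_lt hs⟩).symm
  exact h.congr_of_eventuallyEq hEv rfl

theorem IsSolution.shift {N : E → E} {g : C(ℝ, E)} {v : E} {u : ℝ → E} (hu : IsSolution N g v u)
    {h : ℝ} (hh : 0 ≤ h) : IsSolution N (shiftFlow E h g) (u h) fun t => u (t + h) := by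
  refine ⟨by simp, fun t ht => ?_⟩
  have h1 := hu.2 (t + h) (by positivity)
  have h2 : HasDerivWithinAt (fun s : ℝ => s + h) 1 (Ici 0) t :=
    (hasDerivWithinAt_id t _).add_const h
  have h3 := h1.scomp t h2 (fun s (hs : 0 ≤ s) => add_nonneg hs hh)
  rw [one_smul] at h3
  exact h3

end ODE

/-- Closed pointwise constraints on the forcing, such as norm and tail energy bounds, pass to the
whole hull with the same constants. -/
theorem mem_of_mem_hull {B : Type*} [NormedAddCommGroup B] {f g : C(ℝ, B)} {S : Set B}
    (hS : IsClosed S) (hf : ∀ t, f t ∈ S) (hg : g ∈ hull f) (t : ℝ) : g t ∈ S := by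
  have hcl : IsClosed {g : C(ℝ, B) | g t ∈ S} := hS.preimage (ContinuousEvalConst.continuous_eval_const t)
  refine closure_minimal ?_ hcl hg
  rintro _ ⟨h, rfl⟩
  exact hf (t + h)

/-! ### The cocycle generated by a dissipative equation. -/

section ODECocycle

variable {E : Type*} [NormedAddCommGroup E] [InnerProductSpace ℝ E]

/-- The cocycle on the hull of a bounded forcing generated by a dissipative vector field. -/
theorem exists_cocycle [CompleteSpace E] {N : E → E} {lam : ℝ} (hN : Dissipative N lam)
    (hlam : 0 < lam) (f : C(ℝ, E)) {C : ℝ} (hf : ∀ t, ‖f t‖ ≤ C) :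
    ∃ φ : Cocycle (hullFlow f) E, φ.IsGeneratedBy (IsSolution N) := by
  have hC : 0 ≤ C := (norm_nonneg _).trans (hf 0)
  have hg : ∀ (g : hull f) t, ‖g.1 t‖ ≤ C := fun g t =>
    mem_closedBall_zero_iff.1
      (mem_of_mem_hull isClosed_closedBall (fun t => mem_closedBall_zero_iff.2 (hf t)) g.2 t)
  choose U hU using fun (v : E) (g : hull f) => exists_solution hN hlam g.1 (hg g) v
  refine ⟨⟨fun t v g => U v g t, ?_, fun v g => (hU v g).1, fun t τ v g => ?_⟩, fun g v u =>
    ⟨fun hu t => hu.unique hN (hU v g) t.2, fun hu => ⟨(hu 0).trans (hU v g).1, fun t ht => ?_⟩⟩⟩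
  · rw [continuous_iff_continuousAt]
    rintro ⟨t₀, v₀, g₀⟩
    obtain ⟨L, hL⟩ := hN.lipschitz (‖v₀‖ + 1 + C / lam)
    set T : ℝ := t₀ + 1 with hT
    set A : ℝ := Real.exp ((L + 1) * T) with hA
    have hA0 : 0 < A := Real.exp_pos _
    rw [ContinuousAt, Metric.tendsto_nhds]
    intro η hη
    have hε : 0 < η / (4 * A) := by positivity
    have h1 : ∀ᶠ p : ℝ≥0 × E × hull f in 𝓝 (t₀, v₀, g₀),
        dist (U v₀ g₀ p.1) (U v₀ g₀ t₀) < η / 2 := by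
      have hc : Tendsto (fun p : ℝ≥0 × E × hull f => U v₀ g₀ p.1) (𝓝 (t₀, v₀, g₀))
          (𝓝 (U v₀ g₀ t₀)) := by
        refine ((hU v₀ g₀).2 t₀ t₀.2).continuousWithinAt.tendsto.comp
          (tendsto_nhdsWithin_of_tendsto_nhds_of_eventually_within _ ?_
            (Eventually.of_forall fun p => p.1.2))
        exact (NNReal.continuous_coe.comp continuous_fst).tendsto (t₀, v₀, g₀)
      exact Metric.tendsto_nhds.1 hc _ (half_pos hη)
    have h2 : ∀ᶠ p : ℝ≥0 × E × hull f in 𝓝 (t₀, v₀, g₀), dist p.2.1 v₀ < min 1 (η / (4 * A)) :=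
      Metric.tendsto_nhds.1 ((continuous_fst.comp continuous_snd).tendsto (t₀, v₀, g₀)) _
        (lt_min one_pos hε)
    have h3 : ∀ᶠ p : ℝ≥0 × E × hull f in 𝓝 (t₀, v₀, g₀),
        ∀ s ∈ Icc (0 : ℝ) T, dist (g₀.1 s) (p.2.2.1 s) < η / (4 * A) := by
      have hc : Tendsto (fun p : ℝ≥0 × E × hull f => p.2.2.1) (𝓝 (t₀, v₀, g₀)) (𝓝 g₀.1) :=
        (continuous_subtype_val.comp (continuous_snd.comp continuous_snd)).tendsto (t₀, v₀, g₀)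
      exact Metric.tendstoUniformlyOn_iff.1
        (ContinuousMap.tendsto_iff_forall_isCompact_tendstoUniformlyOn.1 hc _ isCompact_Icc) _ hε
    have h4 : ∀ᶠ p : ℝ≥0 × E × hull f in 𝓝 (t₀, v₀, g₀), (p.1 : ℝ) < T :=
      ((NNReal.continuous_coe.comp continuous_fst).tendsto (t₀, v₀, g₀)).eventually
        (Iio_mem_nhds (by simp [hT]))
    filter_upwards [h1, h2, h3, h4] with ⟨t, v, g⟩ h1 h2 h3 h4
    simp only at h1 h2 h3 h4 ⊢
    have hv : ‖v‖ ≤ ‖v₀‖ + 1 := by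
      have := norm_le_norm_add_norm_sub' v v₀
      rw [dist_eq_norm] at h2
      linarith [min_le_left 1 (η / (4 * A))]
    -- The solution driven by g is an approximate solution of the problem driven by g₀; its defect
    -- is the distance of the forcings, uniformly small on [0, T] by the compact-open topology.
    have h5 := dist_le_of_approx_solution hL hε.le (T := T) ((hU v₀ g₀).hasDerivWithinAt_Icc T)
      (fun s hs => ((hU v₀ g₀).norm_le hN hlam hC (hg g₀) hs.1).trans (by linarith))
      ((hU v g).hasDerivWithinAt_Icc T)
      (fun s hs => ((hU v g).norm_le hN hlam hC (hg g) hs.1).trans (by linarith))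
      (fun s hs => by
        rw [dist_add_left, dist_comm]
        exact (h3 s hs).le) t ⟨t.2, h4.le⟩
    rw [(hU v₀ g₀).1, (hU v g).1, dist_comm v₀] at h5
    have h6 : Real.exp ((L + 1) * t) ≤ A := Real.exp_le_exp.2 (by gcongr)
    have h7 : (dist v v₀ + η / (4 * A)) * Real.exp ((L + 1) * t) ≤
        (η / (4 * A) + η / (4 * A)) * A := by
      gcongr
      exact h2.le.trans (min_le_right _ _)
    have h8 : (η / (4 * A) + η / (4 * A)) * A = η / 2 := by field_simp; norm_num
    have h9 := dist_triangle_left (U v g t) (U v₀ g₀ t₀) (U v₀ g₀ t)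
    linarith
  · have h := ((hU v g).shift t.2).unique hN (hU (U v g t) (hullFlow f t g)) τ.2
    rw [NNReal.coe_add, add_comm]
    exact h
  · have h := (hU v g).2 t ht
    have heq : EqOn u (U v g) (Ici 0) := fun s hs => hu ⟨s, hs⟩
    rw [heq ht]
    exact h.congr heq (heq ht)

end ODECocycle

/-! ### Compact global attractors of uniformly compactly dissipative cocycles -/

namespace Cocycle

variable {Y : Type*} [TopologicalSpace Y] {σ : Flow ℝ Y} {W : Type*} [MetricSpace W]

/-- Nearest points in K converge along the ultrafilter and drag the given points with them. This is
the asymptotic compactness used throughout. -/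
theorem exists_tendsto_of_infEDist_tendsto_zero {ι : Type*} (𝒰 : Ultrafilter ι) {a : ι → W}
    {K : Set W} (hK : IsCompact K) (hne : K.Nonempty)
    (h : Tendsto (fun i => infEDist (a i) K) 𝒰 (𝓝 0)) : ∃ q ∈ K, Tendsto a 𝒰 (𝓝 q) := by
  choose k hkK hk using fun i => hK.exists_infEDist_eq_edist hne (a i)
  obtain ⟨q, hqK, hq⟩ := hK.ultrafilter_le_nhds (𝒰.map k)
    (le_principal_iff.2 (Eventually.of_forall hkK : ∀ᶠ i in (𝒰 : Filter ι), k i ∈ K))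
  refine ⟨q, hqK, ?_⟩
  have hq' : Tendsto k 𝒰 (𝓝 q) := hq
  rw [tendsto_iff_edist_tendsto_0] at hq' ⊢
  have h1 : Tendsto (fun i => infEDist (a i) K + edist (k i) q) 𝒰 (𝓝 0) := by
    simpa using h.add hq'
  refine tendsto_of_tendsto_of_tendsto_of_le_of_le tendsto_const_nhds h1 (fun _ => zero_le)
    fun i => ?_
  rw [hk i]
  exact edist_triangle _ _ _

theorem UniformlyAttracts.infEDist_tendsto {φ : Cocycle σ W} {K M : Set W}
    (hK : φ.UniformlyAttracts K) (hM : IsCompact M) {ι : Type*} {l : Filter ι} {t : ι → ℝ≥0}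
    (ht : Tendsto t l atTop) {x : ι → W} (hx : ∀ i, x i ∈ M) (y : ι → Y) :
    Tendsto (fun i => infEDist (φ.toFun (t i) (x i) (y i)) K) l (𝓝 0) := by
  refine tendsto_of_tendsto_of_tendsto_of_le_of_le tendsto_const_nhds ((hK M hM).comp ht)
    (fun _ => zero_le) fun i => ?_
  refine le_trans ?_ (le_iSup (fun y => semiDist (φ.image (t i) M y) K) (y i))
  exact le_iSup₂ (f := fun a (_ : a ∈ φ.image (t i) M (y i)) => infEDist a K) _
    (mem_image_of_mem _ (hx i))

theorem toFun_eq_of_le (φ : Cocycle σ W) {s t : ℝ≥0} (hst : s ≤ t) (x : W) (y : Y) :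
    φ.toFun t x y = φ.toFun s (φ.toFun (t - s) x y) (σ ((t - s : ℝ≥0) : ℝ) y) := by
  rw [← φ.map_add, tsub_add_cancel_of_le hst]

theorem tendsto_sub_const_atTop {ι : Type*} {l : Filter ι} {t : ι → ℝ≥0} (ht : Tendsto t l atTop)
    (s : ℝ≥0) : Tendsto (fun i => t i - s) l atTop := by
  rw [Filter.tendsto_atTop] at ht ⊢
  intro b
  filter_upwards [ht (b + s)] with i hi using le_tsub_of_add_le_right hi

/-- Limit points of `φ(tᵢ, xᵢ, yᵢ)`, `tᵢ → ∞`, `σ(tᵢ, yᵢ) → y`, lie on complete trajectories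
in `K`. -/
theorem mem_image_of_tendsto {φ : Cocycle σ W} {K M : Set W} (hKc : IsCompact K)
    (hne : K.Nonempty) (hK : φ.UniformlyAttracts K) (hM : IsCompact M) {ι : Type*}
    (𝒰 : Ultrafilter ι) {t : ι → ℝ≥0} (ht : Tendsto t 𝒰 atTop) {x : ι → W} (hx : ∀ i, x i ∈ M)
    {y : ι → Y} {y₀ : Y} (hy : Tendsto (fun i => σ (t i : ℝ) (y i)) 𝒰 (𝓝 y₀)) {p : W}
    (hp : Tendsto (fun i => φ.toFun (t i) (x i) (y i)) 𝒰 (𝓝 p)) (s : ℝ≥0) :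
    p ∈ φ.image s K (σ (-(s : ℝ)) y₀) := by
  -- The states s units of time before the end also approach K, hence converge to a point q of K; by
  -- continuity the cocycle carries q to p in time s.
  obtain ⟨q, hqK, hq⟩ := exists_tendsto_of_infEDist_tendsto_zero 𝒰 hKc hne
    (hK.infEDist_tendsto hM (tendsto_sub_const_atTop ht s) hx y)
  refine ⟨q, hqK, ?_⟩
  have hy' : Tendsto (fun i => σ (-(s : ℝ)) (σ (t i : ℝ) (y i))) 𝒰 (𝓝 (σ (-(s : ℝ)) y₀)) :=
    ((σ.continuous continuous_const continuous_id).tendsto y₀).comp hy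
  have h1 := (φ.continuous_toFun.tendsto (s, q, σ (-(s : ℝ)) y₀)).comp
    ((tendsto_const_nhds (x := s)).prodMk_nhds (hq.prodMk_nhds hy'))
  refine tendsto_nhds_unique (h1.congr' ?_) hp
  filter_upwards [ht (mem_atTop s)] with i hi
  have hi : s ≤ t i := hi
  simp only [Function.comp_apply]
  rw [φ.toFun_eq_of_le hi, ← σ.map_add, NNReal.coe_sub hi]
  ring_nf

/-- This replaces the closures in the definition by exact reachability: a point approximated from
ever more remote starting times is a limit to which `mem_image_of_tendsto` applies. -/
theorem mem_pullbackOmega_iff_forall_mem_image {φ : Cocycle σ W} {K : Set W} (hKc : IsCompact K)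
    (hne : K.Nonempty) (hK : φ.UniformlyAttracts K) {y : Y} {p : W} :
    p ∈ φ.pullbackOmega K y ↔ ∀ s : ℝ≥0, p ∈ φ.image s K (σ (-(s : ℝ)) y) := by
  refine ⟨fun hp => ?_, fun hp => mem_iInter.2 fun t =>
    subset_closure (mem_iUnion₂.2 ⟨t, le_rfl, hp t⟩)⟩
  have hex : ∀ n : ℕ, ∃ (τ : ℝ≥0) (x : W), (n : ℝ≥0) ≤ τ ∧ x ∈ K ∧
      dist (φ.toFun τ x (σ (-(τ : ℝ)) y)) p < 1 / ((n : ℝ) + 1) := fun n => by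
    obtain ⟨b, hb, hbp⟩ := Metric.mem_closure_iff.1 (mem_iInter.1 hp n) (1 / ((n : ℝ) + 1))
      Nat.one_div_pos_of_nat
    obtain ⟨τ, hτ, x, hx, rfl⟩ := mem_iUnion₂.1 hb
    exact ⟨τ, x, hτ, hx, by rwa [dist_comm]⟩
  choose τ x hτ hx hp using hex
  have hτ' : Tendsto τ (hyperfilter ℕ) atTop :=
    (tendsto_atTop_mono hτ tendsto_natCast_atTop_atTop).mono_left Nat.hyperfilter_le_atTop
  refine mem_image_of_tendsto hKc hne hK hKc (hyperfilter ℕ) hτ' hx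
    (y := fun n => σ (-(τ n : ℝ)) y) ?_ ?_
  · simp only [← σ.map_add, add_neg_cancel, σ.map_zero_apply]
    exact tendsto_const_nhds
  · refine (tendsto_iff_dist_tendsto_zero.2 ?_).mono_left Nat.hyperfilter_le_atTop
    exact squeeze_zero (fun _ => dist_nonneg) (fun n => (hp n).le)
      tendsto_one_div_add_atTop_nhds_zero_nat

/-- A point lying for every `s` on a trajectory that starts in the compact set `M` at time `-s`
belongs to the pullback limit set of every compact uniformly attracting set. -/
theorem mem_pullbackOmega_of_forall_mem_image {φ : Cocycle σ W} {K M : Set W} (hKc : IsCompact K)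
    (hne : K.Nonempty) (hK : φ.UniformlyAttracts K) (hM : IsCompact M) {y : Y} {p : W}
    (hp : ∀ s : ℝ≥0, p ∈ φ.image s M (σ (-(s : ℝ)) y)) : p ∈ φ.pullbackOmega K y := by
  rw [mem_pullbackOmega_iff_forall_mem_image hKc hne hK]
  choose x hx hxp using fun n : ℕ => hp n
  refine mem_image_of_tendsto hKc hne hK hM (hyperfilter ℕ) (t := fun n => (n : ℝ≥0))
    (tendsto_natCast_atTop_atTop.mono_left Nat.hyperfilter_le_atTop) hx
    (y := fun n => σ (-((n : ℝ≥0) : ℝ)) y) ?_ ?_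
  · simp only [← σ.map_add, add_neg_cancel, σ.map_zero_apply]
    exact tendsto_const_nhds
  · simp only [hxp]
    exact tendsto_const_nhds

theorem pullbackOmega_subset {φ : Cocycle σ W} {K : Set W} (hKc : IsCompact K)
    (hne : K.Nonempty) (hK : φ.UniformlyAttracts K) (y : Y) : φ.pullbackOmega K y ⊆ K := by
  intro p hp
  obtain ⟨x, hx, rfl⟩ := (mem_pullbackOmega_iff_forall_mem_image hKc hne hK).1 hp 0
  simpa [φ.map_zero] using hx

/-- A cocycle over a compact base with a nonempty compact uniformly attracting set has a compact
global attractor. -/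
theorem isCompactGlobalAttractor_pullbackOmega [CompactSpace Y] {φ : Cocycle σ W} {K : Set W}
    (hKc : IsCompact K) (hne : K.Nonempty) (hK : φ.UniformlyAttracts K) :
    φ.IsCompactGlobalAttractor (φ.pullbackOmega K) where
  nonempty y := by
    obtain ⟨k, hk⟩ := hne
    have ht : Tendsto (fun n : ℕ => (n : ℝ≥0)) (hyperfilter ℕ) atTop :=
      tendsto_natCast_atTop_atTop.mono_left Nat.hyperfilter_le_atTop
    obtain ⟨p, -, hp⟩ := exists_tendsto_of_infEDist_tendsto_zero (hyperfilter ℕ) hKc ⟨k, hk⟩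
      (hK.infEDist_tendsto hKc ht (fun _ => hk) fun n : ℕ => σ (-((n : ℝ≥0) : ℝ)) y)
    refine ⟨p, (mem_pullbackOmega_iff_forall_mem_image hKc ⟨k, hk⟩ hK).2
      (mem_image_of_tendsto hKc ⟨k, hk⟩ hK hKc (hyperfilter ℕ) ht (fun _ => hk) ?_ hp)⟩
    simp only [← σ.map_add, add_neg_cancel, σ.map_zero_apply]
    exact tendsto_const_nhds
  isCompact y := hKc.of_isClosed_subset (isClosed_iInter fun _ => isClosed_closure)
    (pullbackOmega_subset hKc hne hK y)
  precompact := hKc.closure_of_subset (iUnion_subset fun y => pullbackOmega_subset hKc hne hK y)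
  invariant t y := by
    have hnat : Tendsto (fun n : ℕ => (n : ℝ≥0)) (hyperfilter ℕ) atTop :=
      tendsto_natCast_atTop_atTop.mono_left Nat.hyperfilter_le_atTop
    refine Subset.antisymm ?_ fun p hp => ?_
    · rintro _ ⟨x, hx, rfl⟩
      rw [mem_pullbackOmega_iff_forall_mem_image hKc hne hK] at hx ⊢
      choose k hk hkx using fun n : ℕ => hx n
      refine mem_image_of_tendsto hKc hne hK hKc (hyperfilter ℕ) (t := fun n => n + t)
        (tendsto_atTop_mono (fun n => le_self_add) hnat) hk (y := fun n => σ (-((n : ℝ≥0) : ℝ)) y) ?_ ?_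
      · simp only [← σ.map_add, NNReal.coe_add, add_neg_cancel_comm]
        exact tendsto_const_nhds
      · have h1 : ∀ n : ℕ, φ.toFun (n + t) (k n) (σ (-((n : ℝ≥0) : ℝ)) y) = φ.toFun t x y :=
          fun n => by rw [φ.map_add, ← σ.map_add, add_neg_cancel, σ.map_zero_apply, ← hkx n]
        simp only [h1]
        exact tendsto_const_nhds
    · rw [mem_pullbackOmega_iff_forall_mem_image hKc hne hK] at hp
      choose k hk hkp using fun n : ℕ => hp (n + t)
      -- Going back n + t from `σ t y` is going back n from y. The states reached over y after time
      -- n accumulate at some q in the fibre of y, and p is the image of q.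
      have hy : ∀ n : ℕ, σ (-(((n : ℝ≥0) + t : ℝ≥0) : ℝ)) (σ t y) = σ (-((n : ℝ≥0) : ℝ)) y :=
        fun n => by rw [← σ.map_add, NNReal.coe_add, neg_add_rev, neg_add_cancel_comm]
      simp only [hy, φ.map_add, ← σ.map_add, add_neg_cancel, σ.map_zero_apply] at hkp
      obtain ⟨q, -, hq⟩ := exists_tendsto_of_infEDist_tendsto_zero (hyperfilter ℕ) hKc hne
        (hK.infEDist_tendsto hKc hnat hk fun n : ℕ => σ (-((n : ℝ≥0) : ℝ)) y)
      refine ⟨q, (mem_pullbackOmega_iff_forall_mem_image hKc hne hK).2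
        (mem_image_of_tendsto hKc hne hK hKc (hyperfilter ℕ) hnat hk ?_ hq), ?_⟩
      · simp only [← σ.map_add, add_neg_cancel, σ.map_zero_apply]
        exact tendsto_const_nhds
      · have h1 := (φ.continuous_toFun.tendsto (t, q, y)).comp
          ((tendsto_const_nhds (x := t)).prodMk_nhds (hq.prodMk_nhds (tendsto_const_nhds (x := y))))
        refine tendsto_nhds_unique h1 ?_
        simp only [Function.comp_def, hkp]
        exact tendsto_const_nhds
  attracts M hM := by
    rw [ENNReal.tendsto_nhds_zero]
    by_contra! hcon
    obtain ⟨ε, hε, hcon⟩ := hcon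
    have hex : ∀ n : ℕ, ∃ (t : ℝ≥0) (x : W) (y : Y), (n : ℝ≥0) ≤ t ∧ x ∈ M ∧
        ε < infEDist (φ.toFun t x y) (⋃ y, φ.pullbackOmega K y) := fun n => by
      obtain ⟨t, hnt, ht⟩ := frequently_atTop.1 hcon n
      obtain ⟨y, hy⟩ := lt_iSup_iff.1 ht
      obtain ⟨_, hy⟩ := lt_iSup_iff.1 hy
      obtain ⟨⟨x, hx, rfl⟩, hy⟩ := lt_iSup_iff.1 hy
      exact ⟨t, x, y, hnt, hx, hy⟩
    choose t x y ht hx hy using hex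
    have ht' : Tendsto t (hyperfilter ℕ) atTop :=
      (tendsto_atTop_mono ht tendsto_natCast_atTop_atTop).mono_left Nat.hyperfilter_le_atTop
    obtain ⟨p, -, hp⟩ := exists_tendsto_of_infEDist_tendsto_zero (hyperfilter ℕ) hKc hne
      (hK.infEDist_tendsto hM ht' hx y)
    -- Compactness of the base is needed here: the end points of the base trajectories must
    -- converge, to locate the fibre that contains p.
    obtain ⟨y₀, -, hy₀⟩ := isCompact_univ.ultrafilter_le_nhds
      ((hyperfilter ℕ).map fun n => σ (t n : ℝ) (y n)) (by simp)
    have hmem : p ∈ ⋃ y, φ.pullbackOmega K y :=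
      mem_iUnion.2 ⟨y₀, (mem_pullbackOmega_iff_forall_mem_image hKc hne hK).2
        (mem_image_of_tendsto hKc hne hK hM (hyperfilter ℕ) ht' hx hy₀ hp)⟩
    have h0 := (continuous_infEDist (s := ⋃ y, φ.pullbackOmega K y)).tendsto p |>.comp hp
    rw [infEDist_zero_of_mem hmem] at h0
    have h1 := le_of_tendsto_of_tendsto' tendsto_const_nhds h0 (fun n => (hy n).le)
    exact absurd h1 (not_le.2 hε)
  levinson := ⟨K, hne, hKc, hK, fun _ => rfl⟩

end Cocycle

/-! ### Operators on `ℓ₂` -/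

theorem hasSum_mul (x y : EllTwo) : HasSum (fun i => x i * y i) (inner ℝ x y) := by
  simpa [mul_comm] using lp.hasSum_inner (𝕜 := ℝ) x y

theorem hasSum_sq (x : EllTwo) : HasSum (fun i => x i ^ 2) (‖x‖ ^ 2) := by
  simpa [sq, real_inner_self_eq_norm_mul_norm] using hasSum_mul x x

theorem memlp_of_abs_le {x : EllTwo} {y : ℤ → ℝ} {c : ℝ} (h : ∀ i, |y i| ≤ c * |x i|) :
    Memℓp y 2 :=
  ((lp.memℓp x).norm.const_mul c).mono h

theorem norm_le_of_abs_le {x y : EllTwo} {c : ℝ} (hc : 0 ≤ c) (h : ∀ i, |y i| ≤ c * |x i|) :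
    ‖y‖ ≤ c * ‖x‖ := by
  have h1 : ‖y‖ ≤ ‖c • x‖ := lp.norm_mono (by norm_num) fun i => by
    simpa [abs_of_nonneg hc] using h i
  rwa [norm_smul, Real.norm_eq_abs, abs_of_nonneg hc] at h1

theorem abs_apply_le_norm (x : EllTwo) (i : ℤ) : |x i| ≤ ‖x‖ :=
  lp.norm_apply_le_norm (by norm_num) x i

/-- `(x_i) ↦ (x_{s(i)})`. -/
noncomputable def permute (s : Equiv.Perm ℤ) : EllTwo →ₗᵢ[ℝ] EllTwo where
  toFun x := ⟨fun i => x (s i), memℓp_gen <| by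
    simpa [Function.comp_def] using (s.summable_iff (f := fun i => x i ^ 2)).2 (hasSum_sq x).summable⟩
  map_add' x y := by ext i; rfl
  map_smul' c x := by ext i; rfl
  norm_map' x := by
    refine (sq_eq_sq₀ (norm_nonneg _) (norm_nonneg _)).1 ?_
    refine (hasSum_sq _).unique ?_
    exact (s.hasSum_iff (f := fun i => x i ^ 2)).2 (hasSum_sq x)

@[simp] theorem permute_apply (s : Equiv.Perm ℤ) (x : EllTwo) (i : ℤ) :
    permute s x i = x (s i) := rfl

/-- Multiplication by a sequence of numbers in `[0, 1]`. -/
noncomputable def weight (θ : ℤ → ℝ) (hθ : ∀ i, θ i ∈ Icc (0 : ℝ) 1) : EllTwo →L[ℝ] EllTwo :=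
  have h : ∀ (x : EllTwo) (i : ℤ), |θ i * x i| ≤ 1 * |x i| := fun x i => by
    rw [abs_mul, abs_of_nonneg (hθ i).1]
    exact mul_le_mul_of_nonneg_right (hθ i).2 (abs_nonneg _)
  LinearMap.mkContinuous
    { toFun := fun x => ⟨fun i => θ i * x i, memlp_of_abs_le (h x)⟩
      map_add' := fun x y => by ext i; exact mul_add _ _ _
      map_smul' := fun c x => by ext i; exact mul_left_comm _ _ _ } 1
    fun x => norm_le_of_abs_le zero_le_one (h x)

@[simp] theorem weight_apply (θ : ℤ → ℝ) (hθ : ∀ i, θ i ∈ Icc (0 : ℝ) 1) (x : EllTwo) (i : ℤ) :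
    weight θ hθ x i = θ i * x i := rfl

/-- The quadratic form `∑ θ_i x_i²`. -/
noncomputable def energy (θ : ℤ → ℝ) (hθ : ∀ i, θ i ∈ Icc (0 : ℝ) 1) (x : EllTwo) : ℝ :=
  inner ℝ x (weight θ hθ x)

section Energy

variable {θ : ℤ → ℝ} {hθ : ∀ i, θ i ∈ Icc (0 : ℝ) 1}

theorem hasSum_energy (x : EllTwo) : HasSum (fun i => θ i * x i ^ 2) (energy θ hθ x) := by
  have h : (fun i => θ i * x i ^ 2) = fun i => x i * weight θ hθ x i := by
    ext i
    rw [weight_apply]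
    ring
  rw [h]
  exact hasSum_mul x (weight θ hθ x)

theorem energy_nonneg (x : EllTwo) : 0 ≤ energy θ hθ x :=
  (hasSum_energy x).nonneg fun i => mul_nonneg (hθ i).1 (sq_nonneg _)

theorem energy_le_norm_sq (x : EllTwo) : energy θ hθ x ≤ ‖x‖ ^ 2 :=
  hasSum_le (fun i => mul_le_of_le_one_left (sq_nonneg _) (hθ i).2) (hasSum_energy x) (hasSum_sq x)

theorem continuous_energy : Continuous (energy θ hθ) :=
  continuous_id.inner (weight θ hθ).continuous

theorem inner_weight_comm (x y : EllTwo) :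
    inner ℝ x (weight θ hθ y) = inner ℝ y (weight θ hθ x) := by
  refine (hasSum_mul x (weight θ hθ y)).unique ?_
  convert! hasSum_mul y (weight θ hθ x) using 2 with i
  simp only [weight_apply]
  ring

/-- Young's inequality for the weighted form, read off from the nonnegativity of the energy of lam x
- y. -/
theorem two_inner_weight_le {lam : ℝ} (hlam : 0 < lam) (x y : EllTwo) :
    2 * inner ℝ y (weight θ hθ x) ≤ lam * energy θ hθ x + energy θ hθ y / lam := by
  have h := energy_nonneg (hθ := hθ) (lam • x - y)
  have h1 : energy θ hθ (lam • x - y) =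
      lam ^ 2 * energy θ hθ x - 2 * lam * inner ℝ y (weight θ hθ x) + energy θ hθ y := by
    simp only [energy, map_sub, map_smul, inner_sub_left, inner_sub_right, real_inner_smul_left,
      real_inner_smul_right, inner_weight_comm x y]
    ring
  have h2 : lam * energy θ hθ x + energy θ hθ y / lam - 2 * inner ℝ y (weight θ hθ x) =
      energy θ hθ (lam • x - y) / lam := by
    rw [h1]; field_simp; ring
  have h3 : 0 ≤ energy θ hθ (lam • x - y) / lam := by positivity
  linarith

end Energy

/-! ### The lattice vector field -/

section Field

variable {F : ℝ → ℝ}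

theorem memlp_comp (hLip : ∀ s : Set ℝ, Bornology.IsBounded s → ∃ L : ℝ≥0, LipschitzOnWith L F s)
    (hF0 : F 0 = 0) (x : EllTwo) : Memℓp (fun i => F (x i)) 2 := by
  obtain ⟨L, hL⟩ := hLip (closedBall 0 ‖x‖) isBounded_closedBall
  refine memlp_of_abs_le (x := x) (c := L) fun i => ?_
  have h := hL.dist_le_mul (x i) (mem_closedBall_zero_iff.2 (abs_apply_le_norm x i)) 0
    (mem_closedBall_zero_iff.2 (by simp))
  simpa [Real.dist_eq, hF0] using h

/-- The vector field `ν (u_{s⁻¹(i)} - 2 u_i + u_{s(i)}) - λ u_i + F(u_i)`. -/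
noncomputable def latticeField (ν lam : ℝ) (hF : ∀ x : EllTwo, Memℓp (fun i => F (x i)) 2)
    (s : Equiv.Perm ℤ) (x : EllTwo) : EllTwo :=
  ν • (permute s⁻¹ x - (2 : ℝ) • x + permute s x) - lam • x + ⟨fun i => F (x i), hF x⟩

variable {ν lam : ℝ} {hF : ∀ x : EllTwo, Memℓp (fun i => F (x i)) 2}

theorem latticeField_apply (s : Equiv.Perm ℤ) (x : EllTwo) (i : ℤ) :
    latticeField ν lam hF s x i =
      ν * (x (s⁻¹ i) - 2 * x i + x (s i)) - lam * x i + F (x i) := rfl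

/-- Permutations act isometrically, so the Laplacian part has norm at most 1 + 2 + 1 whatever s is.
The uniformity in s lets one Grönwall constant serve all n. -/
theorem exists_lipschitzOnWith_latticeField
    (hLip : ∀ s : Set ℝ, Bornology.IsBounded s → ∃ L : ℝ≥0, LipschitzOnWith L F s) (R : ℝ) :
    ∃ L : ℝ≥0, ∀ s, LipschitzOnWith L (latticeField ν lam hF s) (closedBall 0 R) := by
  obtain ⟨L, hL⟩ := hLip (closedBall 0 R) isBounded_closedBall
  refine ⟨‖ν‖₊ * 4 + ‖lam‖₊ + L, fun s => LipschitzOnWith.of_dist_le_mul fun x hx y hy => ?_⟩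
  rw [mem_closedBall_zero_iff] at hx hy
  set fx : EllTwo := ⟨fun i => F (x i), hF x⟩ with hfx
  set fy : EllTwo := ⟨fun i => F (y i), hF y⟩ with hfy
  have h1 : ‖fx - fy‖ ≤ L * ‖x - y‖ := norm_le_of_abs_le L.2 fun i => by
    have h := hL.dist_le_mul (x i) (mem_closedBall_zero_iff.2 ((abs_apply_le_norm x i).trans hx))
      (y i) (mem_closedBall_zero_iff.2 ((abs_apply_le_norm y i).trans hy))
    exact h
  have h2 : latticeField ν lam hF s x - latticeField ν lam hF s y =
      ν • (permute s⁻¹ (x - y) - (2 : ℝ) • (x - y) + permute s (x - y)) - lam • (x - y) +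
        (fx - fy) := by
    rw [latticeField, latticeField, ← hfx, ← hfy, map_sub, map_sub]
    module
  have h3 : ‖permute s⁻¹ (x - y) - (2 : ℝ) • (x - y) + permute s (x - y)‖ ≤ 4 * ‖x - y‖ := by
    refine (norm_add_le _ _).trans ?_
    have h := norm_sub_le (permute s⁻¹ (x - y)) ((2 : ℝ) • (x - y))
    rw [norm_smul, LinearIsometry.norm_map, Real.norm_ofNat] at h
    rw [LinearIsometry.norm_map]
    linarith
  rw [dist_eq_norm, dist_eq_norm, h2]
  refine (norm_add_le _ _).trans ?_
  have h4 := norm_sub_le (ν • (permute s⁻¹ (x - y) - (2 : ℝ) • (x - y) + permute s (x - y)))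
    (lam • (x - y))
  rw [norm_smul, norm_smul] at h4
  have h5 := mul_le_mul_of_nonneg_left h3 (norm_nonneg ν)
  push_cast
  linarith

/-- Summation by parts along the bonds from i to s i: with a = x i and b = x (s i), a bond
contributes -θ(s i) (b - a)², which has a good sign, plus a commutator (θ(s i) - θ i) a (a - b),
bounded through δ. The case θ = 1, δ = 0 is plain dissipativity. -/
theorem inner_latticeField_weight_le (hν : 0 ≤ ν) (hFs : ∀ s : ℝ, F s * s ≤ 0) {θ : ℤ → ℝ}
    {hθ : ∀ i, θ i ∈ Icc (0 : ℝ) 1} {s : Equiv.Perm ℤ} {δ : ℝ}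
    (hδ : ∀ i, |θ (s i) - θ i| ≤ δ) (x : EllTwo) :
    inner ℝ (latticeField ν lam hF s x) (weight θ hθ x) ≤
      2 * ν * δ * ‖x‖ ^ 2 - lam * energy θ hθ x := by
  have h1 : HasSum (fun i => (x (s i) - x i) * (θ i * x i))
      (inner ℝ (permute s x - x) (weight θ hθ x)) := hasSum_mul (permute s x - x) (weight θ hθ x)
  -- Reindexing by s places the backward differences on the same bonds as the forward ones in `h1`.
  have h2 : HasSum (fun i => (x i - x (s i)) * (θ (s i) * x (s i)))
      (inner ℝ (permute s⁻¹ x - x) (weight θ hθ x)) := by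
    have h := (s.hasSum_iff (f := fun i => (x (s⁻¹ i) - x i) * (θ i * x i))).2
      (hasSum_mul (permute s⁻¹ x - x) (weight θ hθ x))
    simpa [Function.comp_def] using h
  -- The coefficients come from |a (a - b)| ≤ a² + |a b| ≤ 3/2 a² + 1/2 b².
  have h3 : HasSum (fun i => δ * (3 / 2 * x i ^ 2 + 1 / 2 * x (s i) ^ 2)) (δ * (2 * ‖x‖ ^ 2)) := by
    have h := ((hasSum_sq x).mul_left (3 / 2)).add
      ((hasSum_sq (permute s x)).mul_left (1 / 2)) |>.mul_left δ
    rw [LinearIsometry.norm_map] at h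
    convert! h using 1
    ring
  have h4 := hasSum_le (fun i => ?_) (h1.add h2) h3
  · have h5 : HasSum (fun i => F (x i) * (θ i * x i))
        (inner ℝ (⟨fun i => F (x i), hF x⟩ : EllTwo) (weight θ hθ x)) :=
      hasSum_mul ⟨fun i => F (x i), hF x⟩ (weight θ hθ x)
    have h6 := hasSum_le (fun i => ?_) h5 hasSum_zero
    · have h7 : latticeField ν lam hF s x =
          ν • ((permute s x - x) + (permute s⁻¹ x - x)) - lam • x + ⟨fun i => F (x i), hF x⟩ := by
        rw [latticeField]; module
      rw [h7, inner_add_left, inner_sub_left, real_inner_smul_left, real_inner_smul_left,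
        inner_add_left, energy]
      have h8 := mul_le_mul_of_nonneg_left h4 hν
      linarith
    · have h := mul_nonpos_of_nonneg_of_nonpos (hθ i).1 (hFs (x i))
      linarith
  · have hδ0 : 0 ≤ δ := (abs_nonneg _).trans (hδ i)
    set a := x i
    set b := x (s i)
    have e1 : (b - a) * (θ i * a) + (a - b) * (θ (s i) * b) =
        (θ (s i) - θ i) * (a * (a - b)) - θ (s i) * (b - a) ^ 2 := by ring
    have e2 : 0 ≤ θ (s i) * (b - a) ^ 2 := mul_nonneg (hθ _).1 (sq_nonneg _)
    have e3 : (θ (s i) - θ i) * (a * (a - b)) ≤ δ * |a * (a - b)| := by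
      refine (le_abs_self _).trans ?_
      rw [abs_mul]
      exact mul_le_mul_of_nonneg_right (hδ i) (abs_nonneg _)
    have e4 : |a * (a - b)| ≤ 3 / 2 * a ^ 2 + 1 / 2 * b ^ 2 := by
      rw [abs_le]
      constructor <;> nlinarith [sq_nonneg (a - b), sq_nonneg (a + b)]
    have e5 := mul_le_mul_of_nonneg_left e4 hδ0
    linarith

theorem dissipative_latticeField (hν : 0 ≤ ν)
    (hLip : ∀ s : Set ℝ, Bornology.IsBounded s → ∃ L : ℝ≥0, LipschitzOnWith L F s)
    (hFs : ∀ s : ℝ, F s * s ≤ 0) (s : Equiv.Perm ℤ) :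
    Dissipative (latticeField ν lam hF s) lam where
  lipschitz R := (exists_lipschitzOnWith_latticeField hLip R).imp fun _ h => h s
  inner_le x := by
    have hθ : ∀ i : ℤ, (fun _ => 1 : ℤ → ℝ) i ∈ Icc (0 : ℝ) 1 := fun _ => by simp
    have h := inner_latticeField_weight_le (lam := lam) (hF := hF) hν hFs (hθ := hθ) (s := s)
      (δ := 0) (by simp) x
    have h1 : weight (fun _ => 1) hθ x = x := by ext i; simp
    rw [energy, h1, real_inner_self_eq_norm_sq] at h
    linarith

/-- The weighted energy estimate along solutions. -/
theorem energy_le_of_isSolution (hν : 0 ≤ ν) (hlam : 0 < lam) (hFs : ∀ s : ℝ, F s * s ≤ 0)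
    {θ : ℤ → ℝ} {hθ : ∀ i, θ i ∈ Icc (0 : ℝ) 1} {s : Equiv.Perm ℤ} {δ D B : ℝ}
    (hδ : ∀ i, |θ (s i) - θ i| ≤ δ) {g : C(ℝ, EllTwo)} (hg : ∀ t, energy θ hθ (g t) ≤ B)
    {v : EllTwo} {u : ℝ → EllTwo} (hu : IsSolution (latticeField ν lam hF s) g v u)
    (hD : ∀ t, 0 ≤ t → ‖u t‖ ^ 2 ≤ D) {t : ℝ} (ht : 0 ≤ t) :
    energy θ hθ (u t) ≤
      Real.exp (-lam * t) * energy θ hθ v + (4 * ν * δ * D + B / lam) / lam := by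
  have hδ0 : 0 ≤ δ := (abs_nonneg _).trans (hδ 0)
  have hD0 : 0 ≤ D := (sq_nonneg _).trans (hD 0 le_rfl)
  have hB0 : 0 ≤ B := (energy_nonneg _).trans (hg 0)
  have h := le_exp_mul_add_of_deriv_le (w := fun t => energy θ hθ (u t)) hlam
    (c := 4 * ν * δ * D + B / lam) (by positivity)
    (w' := fun t => 2 * inner ℝ (latticeField ν lam hF s (u t) + g t) (weight θ hθ (u t)))
    (fun r hr => ?_) (fun r hr => ?_) ht
  · rwa [hu.1] at h
  · have h1 := hu.2 r hr
    have h2 := h1.inner ℝ ((weight θ hθ).hasFDerivAt.comp_hasDerivWithinAt r h1)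
    convert! h2 using 1
    rw [Function.comp_apply, inner_weight_comm (u r), two_mul]
  · have h1 := inner_latticeField_weight_le (lam := lam) (hF := hF) hν hFs (hθ := hθ) hδ (u r)
    have h2 := two_inner_weight_le (hθ := hθ) hlam (u r) (g r)
    have h3 : 4 * ν * δ * ‖u r‖ ^ 2 ≤ 4 * ν * δ * D := by
      have := hD r hr
      gcongr
    have h4 : energy θ hθ (g r) / lam ≤ B / lam := by
      have := hg r
      gcongr
    rw [inner_add_left]
    linarith

end Field

/-! ### Truncations and tails -/

/-- The truncation of a sequence to the sites `|i| < n`. -/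
noncomputable def trunc (n : ℕ) : EllTwo →L[ℝ] EllTwo :=
  weight (fun i => if |i| < n then 1 else 0) fun i => by split_ifs <;> simp

theorem trunc_apply (n : ℕ) (x : EllTwo) (i : ℤ) : trunc n x i = if |i| < n then x i else 0 := by
  simp [trunc]

theorem sub_trunc_apply (n : ℕ) (x : EllTwo) (i : ℤ) :
    (x - trunc n x) i = if |i| < n then 0 else x i := by
  change x i - trunc n x i = _
  rw [trunc_apply]
  split_ifs <;> simp

theorem norm_trunc_le (n : ℕ) (x : EllTwo) : ‖trunc n x‖ ≤ ‖x‖ := by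
  simpa using norm_le_of_abs_le (x := x) (y := trunc n x) zero_le_one fun i => by
    rw [trunc_apply]; split_ifs <;> simp

theorem norm_sub_trunc_le (n : ℕ) (x : EllTwo) : ‖x - trunc n x‖ ≤ ‖x‖ := by
  simpa using norm_le_of_abs_le (x := x) (y := x - trunc n x) zero_le_one fun i => by
    rw [sub_trunc_apply]; split_ifs <;> simp

theorem norm_sub_trunc_anti {m n : ℕ} (h : m ≤ n) (x : EllTwo) :
    ‖x - trunc n x‖ ≤ ‖x - trunc m x‖ := by
  simpa using norm_le_of_abs_le (x := x - trunc m x) (y := x - trunc n x) zero_le_one fun i => by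
    have : (m : ℤ) ≤ n := by exact_mod_cast h
    rw [sub_trunc_apply, sub_trunc_apply]
    split_ifs
    · simp
    · simp
    · omega
    · simp

theorem exists_norm_sub_trunc_lt (x : EllTwo) {ε : ℝ} (hε : 0 < ε) :
    ∃ n : ℕ, ‖x - trunc n x‖ < ε := by
  have h : HasSum (fun i => lp.single 2 i (x i)) x := lp.hasSum_single (by norm_num) x
  obtain ⟨S, hS⟩ := (Metric.tendsto_nhds.1 h ε hε).exists
  refine ⟨S.sup Int.natAbs + 1, lt_of_le_of_lt ?_ hS⟩
  rw [dist_comm, dist_eq_norm]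
  refine lp.norm_mono (by norm_num) fun i => ?_
  rw [sub_trunc_apply]
  split_ifs with hi
  · simp
  · have hiS : i ∉ S := fun hiS => hi <| by
      have := Finset.le_sup (f := Int.natAbs) hiS
      rw [Int.abs_eq_natAbs]
      exact_mod_cast Nat.lt_succ_of_le this
    refine le_of_eq ?_
    change ‖x i‖ = ‖x i - (∑ j ∈ S, lp.single 2 j (x j) : EllTwo) i‖
    rw [lp.coeFn_sum, Finset.sum_apply, Finset.sum_eq_zero, sub_zero]
    intro j hj
    have hij : i ≠ j := fun hij => hiS (hij ▸ hj)
    exact lp.single_apply_ne (E := fun _ : ℤ => ℝ) 2 j (x j) hij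

/-- Tails are uniformly small on compact sets. -/
theorem exists_forall_norm_sub_trunc_le {S : Set EllTwo} (hS : IsCompact S) {ε : ℝ} (hε : 0 < ε) :
    ∃ m : ℕ, ∀ n ≥ m, ∀ x ∈ S, ‖x - trunc n x‖ ≤ ε := by
  obtain ⟨T, -, hT, hST⟩ := hS.finite_cover_balls (half_pos hε)
  choose m hm using fun x : EllTwo => exists_norm_sub_trunc_lt x (half_pos hε)
  obtain ⟨M, hM⟩ := (hT.image m).bddAbove
  refine ⟨M, fun n hn x hx => ?_⟩
  obtain ⟨c, hc, hxc⟩ := mem_iUnion₂.1 (hST hx)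
  rw [mem_ball, dist_eq_norm] at hxc
  have h1 := (norm_sub_trunc_anti ((hM (mem_image_of_mem m hc)).trans hn) c).trans (hm c).le
  have h2 := norm_sub_trunc_le n (x - c)
  have h3 : x - trunc n x = ((x - c) - trunc n (x - c)) + (c - trunc n c) := by
    rw [map_sub]; abel
  rw [h3]
  linarith [norm_add_le ((x - c) - trunc n (x - c)) (c - trunc n c)]

/-- The weight vanishing for `|i| ≤ k + 1` and equal to `1` for `|i| ≥ 2 (k + 1)`. -/
noncomputable def tailWeight (k : ℕ) (i : ℤ) : ℝ := max 0 (min 1 (|(i : ℝ)| / (k + 1) - 1))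

theorem tailWeight_mem (k : ℕ) (i : ℤ) : tailWeight k i ∈ Icc (0 : ℝ) 1 :=
  ⟨le_max_left _ _, max_le zero_le_one (min_le_left _ _)⟩

theorem tailWeight_mono (k : ℕ) {i j : ℤ} (h : |i| ≤ |j|) : tailWeight k i ≤ tailWeight k j := by
  have h' : |(i : ℝ)| ≤ |(j : ℝ)| := by exact_mod_cast h
  unfold tailWeight
  gcongr

theorem tailWeight_eq_zero {k : ℕ} {i : ℤ} (h : |i| ≤ k + 1) : tailWeight k i = 0 := by
  have h' : |(i : ℝ)| ≤ k + 1 := by exact_mod_cast h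
  have h1 : |(i : ℝ)| / (k + 1) ≤ 1 := div_le_one_of_le₀ h' (by positivity)
  rw [tailWeight, min_eq_right (by linarith), max_eq_left (by linarith)]

theorem tailWeight_eq_one {k : ℕ} {i : ℤ} (h : 2 * (k + 1) ≤ |i|) : tailWeight k i = 1 := by
  have h' : (2 : ℝ) * (k + 1) ≤ |(i : ℝ)| := by exact_mod_cast h
  have h1 : 2 ≤ |(i : ℝ)| / (k + 1) := (le_div_iff₀ (by positivity)).2 h'
  rw [tailWeight, min_eq_left (by linarith), max_eq_right zero_le_one]

theorem abs_tailWeight_sub_le (k : ℕ) {i j : ℤ} (h : |(|i| - |j|)| ≤ 1) :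
    |tailWeight k i - tailWeight k j| ≤ 1 / ((k : ℝ) + 1) := by
  have h' : |(|(i : ℝ)| - |(j : ℝ)|)| ≤ 1 := by exact_mod_cast h
  set a := |(i : ℝ)| / (k + 1) - 1 with ha
  set b := |(j : ℝ)| / (k + 1) - 1 with hb
  have h1 : |tailWeight k i - tailWeight k j| ≤ |min 1 a - min 1 b| := by
    simpa only [tailWeight, max_comm] using abs_max_sub_max_le_abs (min 1 a) (min 1 b) 0
  have h2 : |min 1 a - min 1 b| ≤ |a - b| := by
    simpa using abs_min_sub_min_le_max 1 a 1 b
  have h3 : a - b = (|(i : ℝ)| - |(j : ℝ)|) / (k + 1) := by rw [ha, hb]; ring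
  refine h1.trans (h2.trans ?_)
  rw [h3, abs_div, abs_of_pos (by positivity : (0 : ℝ) < k + 1)]
  gcongr

/-- `∑ θ_i x_i²` for the `k`-th tail weight. -/
noncomputable def tailEnergy (k : ℕ) : EllTwo → ℝ := energy (tailWeight k) (tailWeight_mem k)

theorem tailEnergy_le_norm_sub_trunc (k : ℕ) (x : EllTwo) :
    tailEnergy k x ≤ ‖x - trunc k x‖ ^ 2 := by
  refine hasSum_le (fun i => ?_) (hasSum_energy x) (hasSum_sq (x - trunc k x))
  rw [sub_trunc_apply]
  split_ifs with hi
  · rw [tailWeight_eq_zero (by linarith)]; simp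
  · exact mul_le_of_le_one_left (sq_nonneg _) (tailWeight_mem k i).2

/-- Together with `tailEnergy_le_norm_sub_trunc` this sandwiches the smoothed tail energy between
sharp tails; the price is the factor 2 in the cut-off index. -/
theorem norm_sub_trunc_sq_le {k m : ℕ} (h : 2 * (k + 1) ≤ m) (x : EllTwo) :
    ‖x - trunc m x‖ ^ 2 ≤ tailEnergy k x := by
  refine hasSum_le (fun i => ?_) (hasSum_sq (x - trunc m x)) (hasSum_energy x)
  rw [sub_trunc_apply]
  split_ifs with hi
  · simpa using mul_nonneg (tailWeight_mem k i).1 (sq_nonneg (x i))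
  · have : 2 * ((k : ℤ) + 1) ≤ m := by exact_mod_cast h
    rw [tailWeight_eq_one (by linarith), one_mul]

theorem tailEnergy_trunc_le (k m : ℕ) (x : EllTwo) : tailEnergy k (trunc m x) ≤ tailEnergy k x := by
  refine hasSum_le (fun i => ?_) (hasSum_energy (trunc m x)) (hasSum_energy x)
  rw [trunc_apply]
  split_ifs with hi
  · exact le_rfl
  · simpa using mul_nonneg (tailWeight_mem k i).1 (sq_nonneg (x i))

theorem tailEnergy_trunc_eq_zero {k m : ℕ} (h : m ≤ k) (x : EllTwo) :
    tailEnergy k (trunc m x) = 0 := by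
  refine (hasSum_energy (trunc m x)).unique ?_
  convert! hasSum_zero using 2 with i
  rw [trunc_apply]
  split_ifs with hi
  · have : (m : ℤ) ≤ k := by exact_mod_cast h
    rw [tailWeight_eq_zero (by linarith), zero_mul]
  · simp

/-- The vectors in a ball whose tail energies are bounded by a given sequence. -/
def tailSet (R : ℝ) (e : ℕ → ℝ) : Set EllTwo := {x | ‖x‖ ≤ R ∧ ∀ k, tailEnergy k x ≤ e k}

theorem isClosed_tailSet (R : ℝ) (e : ℕ → ℝ) : IsClosed (tailSet R e) := by
  have h : tailSet R e = closedBall 0 R ∩ ⋂ k, tailEnergy k ⁻¹' Iic (e k) := by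
    ext x
    simp [tailSet]
  rw [h]
  exact isClosed_closedBall.inter
    (isClosed_iInter fun k => isClosed_Iic.preimage continuous_energy)

/-- Distance to the tail set of a vector with finitely many small tail energies. -/
theorem exists_mem_tailSet_dist_le {R : ℝ} {e : ℕ → ℝ} (he : ∀ k, 0 ≤ e k) {m j : ℕ}
    (hj : 2 * (j + 1) ≤ m) {x : EllTwo} (hx : ‖x‖ ≤ R) (hxe : ∀ k < m, tailEnergy k x ≤ e k) :
    ∃ y ∈ tailSet R e, dist x y ^ 2 ≤ e j := by
  -- Truncation lowers every tail energy and kills those with k ≥ m, so only finitely many bounds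
  -- need to be known for x.
  refine ⟨trunc m x, ⟨(norm_trunc_le m x).trans hx, fun k => ?_⟩, ?_⟩
  · rcases lt_or_ge k m with hk | hk
    · exact (tailEnergy_trunc_le k m x).trans (hxe k hk)
    · rw [tailEnergy_trunc_eq_zero hk]
      exact he k
  · rw [dist_eq_norm]
    exact (norm_sub_trunc_sq_le hj x).trans (hxe j (by omega))

/-! ### Embedding of the finite-dimensional systems into `ℓ₂` -/

theorem site_injective (n : ℕ) : Function.Injective (site n) := fun i j h => by
  unfold site at h
  exact Fin.ext (by omega)

theorem abs_site_le (n : ℕ) (j : Fin (2 * n + 1)) : |site n j| ≤ n := by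
  unfold site
  rw [abs_le]
  omega

theorem exists_site_eq {n : ℕ} {i : ℤ} (hi : |i| ≤ n) : ∃ j, site n j = i := by
  rw [abs_le] at hi
  refine ⟨⟨(i + n).toNat, by omega⟩, ?_⟩
  simp only [site]
  omega

theorem embed_apply (n : ℕ) (v : Space n) (i : ℤ) :
    embed n v i = ∑ j, if site n j = i then v j else 0 := by
  rw [embed, lp.coeFn_sum, Finset.sum_apply]
  refine Finset.sum_congr rfl fun j _ => ?_
  split_ifs with h
  · subst h
    exact lp.single_apply_self (E := fun _ : ℤ => ℝ) 2 (site n j) (v j)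
  · exact lp.single_apply_ne (E := fun _ : ℤ => ℝ) 2 (site n j) (v j) (Ne.symm h)

@[simp] theorem embed_apply_site (n : ℕ) (v : Space n) (j : Fin (2 * n + 1)) :
    embed n v (site n j) = v j := by
  simp [embed_apply, (site_injective n).eq_iff]

theorem embed_apply_of_lt {n : ℕ} (v : Space n) {i : ℤ} (hi : n < |i|) : embed n v i = 0 := by
  rw [embed_apply]
  refine Finset.sum_eq_zero fun j _ => if_neg fun h => ?_
  have := abs_site_le n j
  rw [h] at this
  omega

/-- Two vectors agree if they agree at the sites `|i| ≤ n` and vanish elsewhere. -/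
theorem ext_site {n : ℕ} {x y : EllTwo} (h : ∀ j, x (site n j) = y (site n j))
    (h' : ∀ i : ℤ, n < |i| → x i = y i) : x = y := by
  ext i
  rcases le_or_gt |i| n with hi | hi
  · obtain ⟨j, rfl⟩ := exists_site_eq hi
    exact h j
  · exact h' i hi

theorem hasSum_of_embed {n : ℕ} {G : ℤ → ℝ} (hG : ∀ i : ℤ, n < |i| → G i = 0) :
    HasSum G (∑ j, G (site n j)) := by
  refine ((site_injective n).hasSum_iff fun i hi => hG i ?_).1 (hasSum_fintype (G ∘ site n))
  by_contra! h
  exact hi (exists_site_eq h)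

/-- `embed n` as a linear isometry. -/
noncomputable def embedIsometry (n : ℕ) : Space n →ₗᵢ[ℝ] EllTwo where
  toFun := embed n
  map_add' v w := ext_site (n := n)
    (fun j => by
      rw [lp.coeFn_add, Pi.add_apply]
      simp)
    fun i hi => by
      rw [lp.coeFn_add, Pi.add_apply]
      simp [embed_apply_of_lt _ hi]
  map_smul' c v := ext_site (n := n)
    (fun j => by
      rw [lp.coeFn_smul, Pi.smul_apply]
      simp)
    fun i hi => by
      rw [lp.coeFn_smul, Pi.smul_apply]
      simp [embed_apply_of_lt _ hi]
  norm_map' v := by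
    refine (sq_eq_sq₀ (norm_nonneg _) (norm_nonneg _)).1 ?_
    have h := hasSum_of_embed (n := n) (G := fun i => embed n v i ^ 2)
      fun i hi => by simp [embed_apply_of_lt v hi]
    refine (hasSum_sq (embed n v)).unique ?_
    rw [EuclideanSpace.norm_sq_eq]
    simpa using h

@[simp] theorem embedIsometry_apply (n : ℕ) (v : Space n) : embedIsometry n v = embed n v := rfl

/-- The vector of the coordinates `x_{idx j}`. -/
noncomputable def sample (n : ℕ) (idx : Fin (2 * n + 1) → ℤ) (x : EllTwo) : Space n :=
  WithLp.toLp 2 fun j => x (idx j)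

theorem sample_sub (n : ℕ) (idx : Fin (2 * n + 1) → ℤ) (x y : EllTwo) :
    sample n idx (x - y) = sample n idx x - sample n idx y := rfl

/-- The properties of the sampling positions used below. -/
structure IsSampling (n : ℕ) (idx : Fin (2 * n + 1) → ℤ) : Prop where
  injective : Function.Injective idx
  abs_site_le : ∀ j, |site n j| ≤ |idx j|
  eq_site : ∀ j, |site n j| < n → idx j = site n j

theorem isSampling_site (n : ℕ) : IsSampling n (site n) :=
  ⟨site_injective n, fun _ => le_rfl, fun _ _ => rfl⟩

/-- The two boundary entries are read from distance n + 1, hence from farther out than the sites ±n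
where they are placed, so tail bounds survive the swap. -/
theorem isSampling_swappedSite (n : ℕ) : IsSampling n (swappedSite n) where
  injective i j h := by
    apply site_injective n
    have h1 := abs_le.1 (LatticeAttractor.abs_site_le n i)
    have h2 := abs_le.1 (LatticeAttractor.abs_site_le n j)
    unfold swappedSite at h
    split_ifs at h <;> omega
  abs_site_le j := by
    unfold swappedSite
    split_ifs with h1 h2
    · rw [h1, abs_of_nonneg (by positivity), abs_of_neg (by omega)]; omega
    · rw [h2, abs_neg, abs_of_nonneg (by positivity), abs_of_nonneg (by positivity)]; omega
    · exact le_rfl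
  eq_site j hj := by
    rw [abs_lt] at hj
    unfold swappedSite
    rw [if_neg (by omega), if_neg (by omega)]

/-! ### Sampled forcings compared with the original sequence. -/

section Sampling

variable {n : ℕ} {idx : Fin (2 * n + 1) → ℤ}

/-- Sampling moves entries inwards or leaves them in place, where a weight monotone in |i| is no
larger; injectivity prevents an entry from being counted twice. -/
theorem energy_embed_sample_le (h : IsSampling n idx) {θ : ℤ → ℝ} {hθ : ∀ i, θ i ∈ Icc (0 : ℝ) 1}
    (hmono : ∀ i j : ℤ, |i| ≤ |j| → θ i ≤ θ j) (x : EllTwo) :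
    energy θ hθ (embed n (sample n idx x)) ≤ energy θ hθ x := by
  have h1 := hasSum_of_embed (n := n) (G := fun i => θ i * embed n (sample n idx x) i ^ 2)
    fun i hi => by simp [embed_apply_of_lt _ hi]
  rw [(hasSum_energy (hθ := hθ) (embed n (sample n idx x))).unique h1]
  simp only [embed_apply_site]
  calc ∑ j, θ (site n j) * x (idx j) ^ 2
      ≤ ∑ j, θ (idx j) * x (idx j) ^ 2 := Finset.sum_le_sum fun j _ =>
        mul_le_mul_of_nonneg_right (hmono _ _ (h.abs_site_le j)) (sq_nonneg _)
    _ = ∑ i ∈ Finset.univ.map ⟨idx, h.injective⟩, θ i * x i ^ 2 := by simp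
    _ ≤ energy θ hθ x := sum_le_hasSum _
        (fun i _ => mul_nonneg (hθ i).1 (sq_nonneg _)) (hasSum_energy x)

theorem norm_sample_le (h : IsSampling n idx) (x : EllTwo) : ‖sample n idx x‖ ≤ ‖x‖ := by
  have hθ : ∀ i : ℤ, (fun _ => 1 : ℤ → ℝ) i ∈ Icc (0 : ℝ) 1 := fun _ => by simp
  have h1 := energy_embed_sample_le h (hθ := hθ) (fun _ _ _ => le_rfl) x
  have h2 : ∀ x, energy (fun _ => 1) hθ x = ‖x‖ ^ 2 := fun x =>
    (hasSum_energy x).unique (by simpa using hasSum_sq x)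
  rw [h2, h2, ← embedIsometry_apply, LinearIsometry.norm_map] at h1
  exact (sq_le_sq₀ (norm_nonneg _) (norm_nonneg _)).1 h1

/-- Sampling may alter only the boundary sites |i| = n, and these are already zero because the
truncation keeps |i| < n strictly. -/
theorem embed_sample_trunc (h : IsSampling n idx) (x : EllTwo) :
    embed n (sample n idx (trunc n x)) = trunc n x := by
  refine ext_site (n := n) (fun j => ?_) fun i hi => ?_
  · rw [embed_apply_site]
    change trunc n x (idx j) = _
    rcases lt_or_ge |site n j| n with hj | hj
    · rw [h.eq_site j hj]
    · rw [trunc_apply, trunc_apply, if_neg (not_lt.2 (hj.trans (h.abs_site_le j))),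
        if_neg (not_lt.2 hj)]
  · rw [embed_apply_of_lt _ hi, trunc_apply, if_neg (by omega)]

theorem dist_embed_sample_le (h : IsSampling n idx) (x : EllTwo) :
    dist (embed n (sample n idx x)) x ≤ 2 * ‖x - trunc n x‖ := by
  have h1 : embed n (sample n idx x) - x =
      embedIsometry n (sample n idx (x - trunc n x)) - (x - trunc n x) := by
    rw [sample_sub, map_sub, embedIsometry_apply, embedIsometry_apply, embed_sample_trunc h]
    abel
  rw [dist_eq_norm, h1]
  refine (norm_sub_le _ _).trans ?_
  rw [LinearIsometry.norm_map]
  linarith [norm_sample_le h (x - trunc n x)]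

end Sampling

/-- Up to an error below ε / 2, uniform on the set, all vectors are supported on |i| < m, and the
embedded ball of dimension 2 m + 1 is compact. -/
theorem isCompact_tailSet (R : ℝ) {e : ℕ → ℝ} (he : Tendsto e atTop (𝓝 0)) :
    IsCompact (tailSet R e) := by
  refine isCompact_iff_totallyBounded_isComplete.2
    ⟨Metric.totallyBounded_iff.2 fun ε hε => ?_, (isClosed_tailSet R e).isComplete⟩
  obtain ⟨k, hk⟩ := ((tendsto_order.1 he).2 ((ε / 2) ^ 2) (by positivity)).exists
  set m := 2 * (k + 1) with hm
  have hC : IsCompact (embedIsometry m '' closedBall 0 R) :=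
    (isCompact_closedBall 0 R).image (embedIsometry m).continuous
  obtain ⟨t, ht, htC⟩ := Metric.totallyBounded_iff.1 hC.totallyBounded (ε / 2) (half_pos hε)
  refine ⟨t, ht, fun x hx => ?_⟩
  have hmem : trunc m x ∈ embedIsometry m '' closedBall 0 R :=
    ⟨sample m (site m) (trunc m x), mem_closedBall_zero_iff.2
      (((norm_sample_le (isSampling_site m) _).trans (norm_trunc_le m x)).trans hx.1),
      embed_sample_trunc (isSampling_site m) x⟩
  obtain ⟨c, hc, hxc⟩ := mem_iUnion₂.1 (htC hmem)
  refine mem_iUnion₂.2 ⟨c, hc, ?_⟩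
  rw [mem_ball] at hxc ⊢
  have h1 : ‖x - trunc m x‖ ^ 2 < (ε / 2) ^ 2 :=
    ((norm_sub_trunc_sq_le hm.ge x).trans (hx.2 k)).trans_lt hk
  have h2 : dist x (trunc m x) < ε / 2 := by
    rw [dist_eq_norm]
    exact (sq_lt_sq₀ (norm_nonneg _) (by positivity)).1 h1
  linarith [dist_triangle x (trunc m x) c]

/-! ### The cyclic shift and its comparison with the lattice shift. -/

/-- The cyclic shift of the sites `|i| ≤ n`, extended by the identity. -/
noncomputable def cyclicShift (n : ℕ) : Equiv.Perm ℤ :=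
  (Equiv.addRight (1 : Fin (2 * n + 1))).viaEmbedding ⟨site n, site_injective n⟩

theorem cyclicShift_site (n : ℕ) (j : Fin (2 * n + 1)) :
    cyclicShift n (site n j) = site n (j + 1) :=
  Equiv.Perm.viaEmbedding_apply _ ⟨site n, site_injective n⟩ j

theorem cyclicShift_inv_site (n : ℕ) (j : Fin (2 * n + 1)) :
    (cyclicShift n)⁻¹ (site n j) = site n (j - 1) := by
  rw [Equiv.Perm.inv_eq_iff_eq, cyclicShift_site, sub_add_cancel]

theorem cyclicShift_of_lt {n : ℕ} {i : ℤ} (hi : n < |i|) : cyclicShift n i = i := by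
  refine Equiv.Perm.viaEmbedding_apply_of_notMem _ ⟨site n, site_injective n⟩ i ?_
  rintro ⟨j, rfl⟩
  exact absurd (abs_site_le n j) (not_le.2 hi)

theorem cyclicShift_inv_of_lt {n : ℕ} {i : ℤ} (hi : n < |i|) : (cyclicShift n)⁻¹ i = i := by
  rw [Equiv.Perm.inv_eq_iff_eq, cyclicShift_of_lt hi]

theorem site_add_one (n : ℕ) (j : Fin (2 * n + 1)) :
    site n (j + 1) = site n j + 1 ∨ site n j = n ∧ site n (j + 1) = -n := by
  have h := Fin.val_add_one j
  unfold site
  split_ifs at h with hj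
  · right
    rw [hj] at h ⊢
    rw [h]
    simp
    omega
  · left
    rw [h]
    push_cast
    ring

/-- The jump from n to -n does not change |i|. As the tail weights depend on |i| only, the periodic
boundary adds no term to the tail estimate. -/
theorem abs_cyclicShift_sub_le (n : ℕ) (i : ℤ) : |(|cyclicShift n i| - |i|)| ≤ 1 := by
  rcases le_or_gt |i| n with hi | hi
  · obtain ⟨j, rfl⟩ := exists_site_eq hi
    rw [cyclicShift_site]
    rcases site_add_one n j with h | ⟨h1, h2⟩
    · rw [h]
      exact (abs_abs_sub_abs_le_abs_sub _ _).trans (by simp)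
    · rw [h1, h2]; simp
  · rw [cyclicShift_of_lt hi]; simp

/-- Where the two shifts disagree, both images lie outside |i| < n; after truncation the
disagreement is invisible. -/
theorem cyclicShift_eq_or (n : ℕ) (i : ℤ) :
    cyclicShift n i = i + 1 ∨ n ≤ |cyclicShift n i| ∧ n ≤ |i + 1| := by
  rcases le_or_gt |i| n with hi | hi
  · obtain ⟨j, rfl⟩ := exists_site_eq hi
    rw [cyclicShift_site]
    rcases site_add_one n j with h | ⟨h1, h2⟩
    · exact Or.inl h
    · right
      rw [h1, h2, abs_neg, abs_of_nonneg (by positivity), abs_of_nonneg (by positivity)]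
      omega
  · right
    rw [cyclicShift_of_lt hi]
    refine ⟨hi.le, ?_⟩
    rcases lt_abs.1 hi with h | h
    · exact le_abs.2 (Or.inl (by omega))
    · exact le_abs.2 (Or.inr (by omega))

theorem cyclicShift_inv_eq_or (n : ℕ) (i : ℤ) :
    (cyclicShift n)⁻¹ i = i - 1 ∨ n ≤ |(cyclicShift n)⁻¹ i| ∧ n ≤ |i - 1| := by
  rcases le_or_gt |i| n with hi | hi
  · obtain ⟨j, rfl⟩ := exists_site_eq hi
    rw [cyclicShift_inv_site]
    have h := site_add_one n (j - 1)
    rw [sub_add_cancel] at h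
    rcases h with h | ⟨h1, h2⟩
    · left; omega
    · right
      rw [h1, h2, abs_of_nonneg (by positivity), abs_of_nonpos (by omega)]
      omega
  · right
    rw [cyclicShift_inv_of_lt hi]
    refine ⟨hi.le, ?_⟩
    rcases lt_abs.1 hi with h | h
    · exact le_abs.2 (Or.inl (by omega))
    · exact le_abs.2 (Or.inr (by omega))

theorem permute_trunc_eq {n : ℕ} {s s' : Equiv.Perm ℤ}
    (h : ∀ i, s i = s' i ∨ n ≤ |s i| ∧ n ≤ |s' i|) (x : EllTwo) :
    permute s (trunc n x) = permute s' (trunc n x) := by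
  ext i
  rw [permute_apply, permute_apply]
  rcases h i with h | ⟨h1, h2⟩
  · rw [h]
  · rw [trunc_apply, trunc_apply, if_neg (not_lt.2 h1), if_neg (not_lt.2 h2)]

theorem norm_permute_sub_permute_le {n : ℕ} {s s' : Equiv.Perm ℤ}
    (h : ∀ i, s i = s' i ∨ n ≤ |s i| ∧ n ≤ |s' i|) (x : EllTwo) :
    ‖permute s x - permute s' x‖ ≤ 2 * ‖x - trunc n x‖ := by
  have h1 : permute s x - permute s' x =
      permute s (x - trunc n x) - permute s' (x - trunc n x) := by
    rw [map_sub, map_sub, permute_trunc_eq h]; abel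
  rw [h1]
  refine (norm_sub_le _ _).trans ?_
  rw [LinearIsometry.norm_map, LinearIsometry.norm_map, two_mul]

section FiniteField

variable {F : ℝ → ℝ} {ν lam : ℝ} {hF : ∀ x : EllTwo, Memℓp (fun i => F (x i)) 2}

/-- The consistency error of the periodic boundary: the forward and the backward neighbours each
cost twice the tail of x. -/
theorem dist_latticeField_cyclicShift_le (hν : 0 ≤ ν) (n : ℕ) (x : EllTwo) :
    dist (latticeField ν lam hF (Equiv.addRight 1) x) (latticeField ν lam hF (cyclicShift n) x) ≤
      4 * ν * ‖x - trunc n x‖ := by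
  have h1 := norm_permute_sub_permute_le (n := n) (s := cyclicShift n) (s' := Equiv.addRight 1)
    (cyclicShift_eq_or n) x
  have h2 := norm_permute_sub_permute_le (n := n) (s := (cyclicShift n)⁻¹)
    (s' := (Equiv.addRight 1)⁻¹) (cyclicShift_inv_eq_or n) x
  have h3 : latticeField ν lam hF (cyclicShift n) x - latticeField ν lam hF (Equiv.addRight 1) x =
      ν • ((permute (cyclicShift n)⁻¹ x - permute (Equiv.addRight 1)⁻¹ x) +
        (permute (cyclicShift n) x - permute (Equiv.addRight 1) x)) := by
    rw [latticeField, latticeField]; module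
  rw [dist_comm, dist_eq_norm, h3, norm_smul, Real.norm_eq_abs, abs_of_nonneg hν]
  have h4 := mul_le_mul_of_nonneg_left ((norm_add_le _ _).trans (add_le_add h2 h1)) hν
  linarith

/-- The vector field of the system with periodic boundary conditions. -/
noncomputable def periodicField (ν lam : ℝ) (F : ℝ → ℝ) (n : ℕ) (v : Space n) : Space n :=
  WithLp.toLp 2 fun j => ν * (v (j - 1) - 2 * v j + v (j + 1)) - lam * v j + F (v j)

/-- Outside |i| ≤ n the cyclic shift is the identity, so the Laplacian, the damping and F (as F 0 =
0) vanish there. This lets the finite systems inherit every estimate for `latticeField`. -/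
theorem embed_periodicField (hF0 : F 0 = 0) (n : ℕ) (v : Space n) :
    embed n (periodicField ν lam F n v) = latticeField ν lam hF (cyclicShift n) (embed n v) := by
  refine ext_site (n := n) (fun j => ?_) fun i hi => ?_
  · rw [embed_apply_site, latticeField_apply, cyclicShift_site, cyclicShift_inv_site]
    simp only [embed_apply_site]
    rfl
  · rw [embed_apply_of_lt _ hi, latticeField_apply, cyclicShift_of_lt hi, cyclicShift_inv_of_lt hi,
      embed_apply_of_lt _ hi, hF0]
    simp

theorem dissipative_periodicField (hν : 0 ≤ ν)
    (hLip : ∀ s : Set ℝ, Bornology.IsBounded s → ∃ L : ℝ≥0, LipschitzOnWith L F s)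
    (hF0 : F 0 = 0) (hFs : ∀ s : ℝ, F s * s ≤ 0) (n : ℕ) :
    Dissipative (periodicField ν lam F n) lam := by
  have hN := dissipative_latticeField (lam := lam) (hF := memlp_comp hLip hF0) hν hLip hFs
    (cyclicShift n)
  have he := embed_periodicField (ν := ν) (lam := lam) (hF := memlp_comp hLip hF0) hF0 n
  refine ⟨fun R => ?_, fun v => ?_⟩
  · obtain ⟨L, hL⟩ := hN.lipschitz R
    refine ⟨L, LipschitzOnWith.of_dist_le_mul fun v hv w hw => ?_⟩
    rw [← (embedIsometry n).dist_map, ← (embedIsometry n).dist_map v, embedIsometry_apply,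
      embedIsometry_apply, he, he]
    rw [mem_closedBall_zero_iff, ← (embedIsometry n).norm_map, ← mem_closedBall_zero_iff] at hv hw
    exact hL.dist_le_mul _ hv _ hw
  · rw [← (embedIsometry n).inner_map_map, ← (embedIsometry n).norm_map, embedIsometry_apply,
      embedIsometry_apply, he]
    exact hN.inner_le _

/-- Solutions of the periodic system, extended by zero, solve a lattice system. -/
theorem IsSolution.embed (hF0 : F 0 = 0) {n : ℕ} {g : C(ℝ, Space n)} {v : Space n}
    {u : ℝ → Space n} (hu : IsSolution (periodicField ν lam F n) g v u) :
    IsSolution (latticeField ν lam hF (cyclicShift n))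
      ⟨fun t => LatticeAttractor.embed n (g t), (embedIsometry n).continuous.comp g.continuous⟩
      (LatticeAttractor.embed n v) fun t => LatticeAttractor.embed n (u t) := by
  refine ⟨congrArg _ hu.1, fun t ht => ?_⟩
  have h := (embedIsometry n).toContinuousLinearMap.hasFDerivAt.comp_hasDerivWithinAt t (hu.2 t ht)
  rw [map_add] at h
  rw [← embed_periodicField hF0]
  exact h

theorem isLatticeSolution_iff {g : C(ℝ, EllTwo)} {v : EllTwo} {u : ℝ → EllTwo} :
    IsLatticeSolution ν lam F g v u ↔
      IsSolution (latticeField ν lam hF (Equiv.addRight 1)) g v u := by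
  refine and_congr_right fun _ => forall₂_congr fun t _ => ⟨?_, fun h => ⟨_, h, fun i => rfl⟩⟩
  rintro ⟨w, hw, hwi⟩
  convert! hw using 1
  ext i
  exact (hwi i).symm

theorem isApproxSolution_iff {n : ℕ} {g : C(ℝ, Space n)} {v : Space n} {u : ℝ → Space n} :
    IsApproxSolution ν lam F n g v u ↔ IsSolution (periodicField ν lam F n) g v u := by
  refine and_congr_right fun _ => forall₂_congr fun t _ => ⟨?_, fun h => ⟨_, h, fun i => rfl⟩⟩
  rintro ⟨w, hw, hwi⟩
  convert! hw using 1
  ext i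
  exact (hwi i).symm

end FiniteField

/-! ### Lagrange stable forcings -/

/-- The image of the compact hull is closed and contains all translates of Φ f; this transfers
Lagrange stability to the sampled forcings. -/
theorem hull_subset_image {A B : Type*} [NormedAddCommGroup A] [NormedAddCommGroup B]
    {Φ : C(ℝ, A) → C(ℝ, B)} (hΦ : Continuous Φ)
    (hshift : ∀ h f, Φ (shiftFlow A h f) = shiftFlow B h (Φ f)) {f : C(ℝ, A)}
    (hf : IsLagrangeStable f) : hull (Φ f) ⊆ Φ '' hull f := by
  refine closure_minimal ?_ (IsCompact.image hf hΦ).isClosed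
  rintro _ ⟨h, rfl⟩
  exact ⟨shiftFlow A h f, subset_closure ⟨h, rfl⟩, hshift h f⟩

theorem isLagrangeStable_approxForcing (n : ℕ) (idx : Fin (2 * n + 1) → ℤ) {f : C(ℝ, EllTwo)}
    (hf : IsLagrangeStable f) : IsLagrangeStable (approxForcing n idx f) := by
  have hs : Continuous (sample n idx) :=
    (PiLp.continuous_toLp 2 _).comp
      (continuous_pi fun j => (lp.lipschitzWith_one_eval 2 (idx j)).continuous)
  have hΦ : Continuous (approxForcing n idx) :=
    ContinuousMap.continuous_postcomp (X := ℝ) ⟨sample n idx, hs⟩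
  exact (IsCompact.image hf hΦ).of_isClosed_subset isClosed_closure
    (hull_subset_image hΦ (fun _ _ => rfl) hf)

/-- The value f(t) is the translate of f by t evaluated at 0, so the compact hull is mapped onto a
set containing all values. -/
theorem exists_isCompact_forall_apply_mem {B : Type*} [NormedAddCommGroup B] {f : C(ℝ, B)}
    (hf : IsLagrangeStable f) : ∃ S : Set B, IsCompact S ∧ ∀ t, f t ∈ S := by
  refine ⟨(fun g : C(ℝ, B) => g 0) '' hull f,
    IsCompact.image hf (ContinuousEvalConst.continuous_eval_const 0), fun t => ?_⟩
  exact ⟨shiftFlow B t f, subset_closure ⟨t, rfl⟩, congrArg f (zero_add t)⟩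

theorem exists_tailEnergy_bound {S : Set EllTwo} (hS : IsCompact S) :
    ∃ B : ℕ → ℝ, Tendsto B atTop (𝓝 0) ∧ ∀ k, 0 ≤ B k ∧ ∀ x ∈ S, tailEnergy k x ≤ B k := by
  have h0 : ∀ k, 0 ≤ sSup (tailEnergy k '' S) := fun k => Real.sSup_nonneg (by
    rintro _ ⟨x, -, rfl⟩
    exact energy_nonneg x)
  refine ⟨fun k => sSup (tailEnergy k '' S), ?_, fun k => ⟨h0 k, fun x hx =>
    le_csSup (hS.image continuous_energy).bddAbove (mem_image_of_mem _ hx)⟩⟩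
  rw [Metric.tendsto_atTop]
  intro ε hε
  obtain ⟨m, hm⟩ := exists_forall_norm_sub_trunc_le hS (Real.sqrt_pos.2 (half_pos hε))
  refine ⟨m, fun n hn => ?_⟩
  rw [Real.dist_0_eq_abs, abs_of_nonneg (h0 n)]
  refine lt_of_le_of_lt (Real.sSup_le ?_ (half_pos hε).le) (half_lt_self hε)
  rintro _ ⟨x, hx, rfl⟩
  refine (tailEnergy_le_norm_sub_trunc n x).trans ?_
  rw [← Real.sq_sqrt (half_pos hε).le]
  exact pow_le_pow_left₀ (norm_nonneg _) (hm n hn x hx) 2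

/-! ### Absorbing sets -/

theorem exists_exp_mul_le {lam : ℝ} (hlam : 0 < lam) (a : ℝ) {ε : ℝ} (hε : 0 < ε) :
    ∃ T : ℝ≥0, ∀ t : ℝ, T ≤ t → Real.exp (-lam * t) * a ≤ ε := by
  have h : Tendsto (fun t : ℝ => Real.exp (-lam * t) * a) atTop (𝓝 0) := by
    have h1 : Tendsto (fun t : ℝ => -lam * t) atTop atBot :=
      tendsto_id.const_mul_atTop_of_neg (by linarith)
    simpa using (Real.tendsto_exp_atBot.comp h1).mul_const a
  obtain ⟨T, hT⟩ := eventually_atTop.1 ((tendsto_order.1 h).2 ε hε)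
  exact ⟨T.toNNReal, fun t ht => (hT t ((Real.le_coe_toNNReal T).trans ht)).le⟩

theorem IsSolution.norm_le_of_exp_mul_le {E : Type*} [NormedAddCommGroup E]
    [InnerProductSpace ℝ E] {N : E → E} {lam : ℝ} (hN : Dissipative N lam) (hlam : 0 < lam)
    {g : C(ℝ, E)} {C : ℝ} (hC : 0 ≤ C) (hg : ∀ t, ‖g t‖ ≤ C) {v : E} {u : ℝ → E}
    (hu : IsSolution N g v u) {ρ t : ℝ} (hv : ‖v‖ ≤ ρ) (ht : 0 ≤ t)
    (hρ : Real.exp (-lam * t) * ρ ^ 2 ≤ 1) : ‖u t‖ ≤ C / lam + 1 := by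
  have h := hu.norm_sq_le hN hlam hg ht
  have h1 : Real.exp (-lam * t) * ‖v‖ ^ 2 ≤ Real.exp (-lam * t) * ρ ^ 2 := by gcongr
  have h2 : 0 ≤ C / lam := by positivity
  refine abs_le_of_sq_le_sq' ?_ (by positivity) |>.2
  rw [← div_pow] at h
  nlinarith

theorem Cocycle.uniformlyAttracts_of_dist_le {Y : Type*} [TopologicalSpace Y] {σ : Flow ℝ Y}
    {W : Type*} [NormedAddCommGroup W] {φ : Cocycle σ W} {K : Set W}
    (h : ∀ ρ η : ℝ, 0 < η → ∃ T : ℝ≥0, ∀ t ≥ T, ∀ (y : Y) (v : W), ‖v‖ ≤ ρ →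
      ∃ k ∈ K, dist (φ.toFun t v y) k ≤ η) : φ.UniformlyAttracts K := by
  intro M hM
  obtain ⟨ρ, hρ⟩ := hM.isBounded.exists_norm_le
  rw [ENNReal.tendsto_nhds_zero]
  intro ε hε
  obtain ⟨η, hη0, hη⟩ := ENNReal.lt_iff_exists_nnreal_btwn.1 hε
  obtain ⟨T, hT⟩ := h ρ η (by exact_mod_cast hη0)
  filter_upwards [eventually_ge_atTop T] with t ht
  refine iSup_le fun y => iSup₂_le ?_
  rintro _ ⟨v, hv, rfl⟩
  obtain ⟨k, hk, hd⟩ := hT t ht y v (hρ v hv)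
  refine (infEDist_le_edist_of_mem hk).trans (le_trans ?_ hη.le)
  rw [edist_dist]
  exact ENNReal.ofReal_le_of_le_toReal hd

theorem Cocycle.IsCompactGlobalAttractor.mem_image {Y : Type*} [TopologicalSpace Y] {σ : Flow ℝ Y}
    {W : Type*} [MetricSpace W] {φ : Cocycle σ W} {I : Y → Set W}
    (hI : φ.IsCompactGlobalAttractor I) {y : Y} {p : W} (hp : p ∈ I y) (t : ℝ≥0) :
    p ∈ φ.image t (I (σ (-(t : ℝ)) y)) (σ (-(t : ℝ)) y) := by
  rwa [hI.invariant, ← σ.map_add, add_neg_cancel, σ.map_zero_apply]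

section Lattice

variable {F : ℝ → ℝ} {ν lam : ℝ} {hF : ∀ x : EllTwo, Memℓp (fun i => F (x i)) 2}

/-- The asymptotic bound of the `k`-th tail energy of solutions. -/
noncomputable def tailBound (ν lam C : ℝ) (B : ℕ → ℝ) (k : ℕ) : ℝ :=
  (4 * ν * (1 / ((k : ℝ) + 1)) * ((C / lam + 1) ^ 2 + C ^ 2 / lam ^ 2) + B k / lam) / lam

theorem tendsto_tailBound (ν lam C : ℝ) {B : ℕ → ℝ} (hB : Tendsto B atTop (𝓝 0)) :
    Tendsto (tailBound ν lam C B) atTop (𝓝 0) := by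
  have h := (((tendsto_one_div_add_atTop_nhds_zero_nat (𝕜 := ℝ)).const_mul (4 * ν)).mul_const
    ((C / lam + 1) ^ 2 + C ^ 2 / lam ^ 2)).add (hB.div_const lam) |>.div_const lam
  have h1 : tailBound ν lam C B = fun k : ℕ => (4 * ν * (1 / ((k : ℝ) + 1)) *
    ((C / lam + 1) ^ 2 + C ^ 2 / lam ^ 2) + B k / lam) / lam := rfl
  rw [h1]
  simpa using h

theorem tailBound_nonneg (hν : 0 ≤ ν) (hlam : 0 < lam) (C : ℝ) {B : ℕ → ℝ} (hB : ∀ k, 0 ≤ B k)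
    (k : ℕ) : 0 ≤ tailBound ν lam C B k := by
  have := hB k
  unfold tailBound
  positivity

/-- Solutions enter the absorbing ball, and then their tail energies decay. -/
theorem IsSolution.norm_le_and_tailEnergy_le (hν : 0 ≤ ν) (hlam : 0 < lam)
    (hLip : ∀ s : Set ℝ, Bornology.IsBounded s → ∃ L : ℝ≥0, LipschitzOnWith L F s)
    (hFs : ∀ s : ℝ, F s * s ≤ 0) {s : Equiv.Perm ℤ} (hs : ∀ i, |(|s i| - |i|)| ≤ 1)
    {g : C(ℝ, EllTwo)} {C : ℝ} (hC : 0 ≤ C) (hg : ∀ t, ‖g t‖ ≤ C) {B : ℕ → ℝ}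
    (hgB : ∀ k t, tailEnergy k (g t) ≤ B k) {v : EllTwo} {u : ℝ → EllTwo}
    (hu : IsSolution (latticeField ν lam hF s) g v u) {ρ T τ : ℝ} (hv : ‖v‖ ≤ ρ) (hT : 0 ≤ T)
    (hτ : 0 ≤ τ) (hρ : ∀ t, T ≤ t → Real.exp (-lam * t) * ρ ^ 2 ≤ 1) :
    ‖u (T + τ)‖ ≤ C / lam + 1 ∧ ∀ k, tailEnergy k (u (T + τ)) ≤
      Real.exp (-lam * τ) * (C / lam + 1) ^ 2 + tailBound ν lam C B k := by
  have hN := dissipative_latticeField (lam := lam) (hF := hF) hν hLip hFs s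
  refine ⟨hu.norm_le_of_exp_mul_le hN hlam hC hg hv (add_nonneg hT hτ)
    (hρ _ (by linarith)), fun k => ?_⟩
  have huT := hu.norm_le_of_exp_mul_le hN hlam hC hg hv hT (hρ T le_rfl)
  -- The solution is restarted at T, inside the absorbing ball, so that the tail estimate no longer
  -- depends on ρ.
  have hw := hu.shift hT
  have hgT : ∀ t, ‖shiftFlow EllTwo T g t‖ ≤ C := fun t => hg (t + T)
  have hgBT : ∀ t, tailEnergy k (shiftFlow EllTwo T g t) ≤ B k := fun t => hgB k (t + T)
  have hCl : 0 ≤ C / lam := by positivity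
  have huT2 : ‖u T‖ ^ 2 ≤ (C / lam + 1) ^ 2 := pow_le_pow_left₀ (norm_nonneg _) huT 2
  have h := energy_le_of_isSolution (θ := tailWeight k) (hθ := tailWeight_mem k)
    (δ := 1 / ((k : ℝ) + 1)) (D := (C / lam + 1) ^ 2 + C ^ 2 / lam ^ 2) (B := B k) hν hlam hFs
    (fun i => abs_tailWeight_sub_le k (hs i)) hgBT hw (fun t ht => ?_) hτ
  · rw [add_comm T τ]
    refine h.trans (add_le_add ?_ le_rfl)
    gcongr
    exact (energy_le_norm_sq _).trans huT2
  · refine (hw.norm_sq_le hN hlam hgT ht).trans (add_le_add ?_ le_rfl)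
    have h1 : Real.exp (-lam * t) ≤ 1 := Real.exp_le_one_iff.2 (by nlinarith)
    exact (mul_le_of_le_one_left (sq_nonneg _) h1).trans huT2

/-- The compact set that attracts the lattice system and contains the attractors of all the
finite-dimensional systems. -/
def absorbingSet (ν lam C : ℝ) (B : ℕ → ℝ) : Set EllTwo :=
  -- The slack 1 / (k + 1) leaves room for the decaying transient and still tends to 0, which keeps
  -- the set compact.
  tailSet (C / lam + 1) fun k => tailBound ν lam C B k + 1 / ((k : ℝ) + 1)

theorem isCompact_absorbingSet (ν lam C : ℝ) {B : ℕ → ℝ} (hB : Tendsto B atTop (𝓝 0)) :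
    IsCompact (absorbingSet ν lam C B) := by
  refine isCompact_tailSet _ ?_
  simpa using (tendsto_tailBound ν lam C hB).add (tendsto_one_div_add_atTop_nhds_zero_nat (𝕜 := ℝ))

theorem zero_mem_absorbingSet (hν : 0 ≤ ν) (hlam : 0 < lam) {C : ℝ} (hC : 0 ≤ C) {B : ℕ → ℝ}
    (hB : ∀ k, 0 ≤ B k) : (0 : EllTwo) ∈ absorbingSet ν lam C B := by
  refine ⟨by simp only [norm_zero]; positivity, fun k => ?_⟩
  have h : tailEnergy k 0 = 0 := by simp [tailEnergy, energy]
  have := tailBound_nonneg hν hlam C hB k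
  rw [h]
  positivity

/-- No common time makes all tail energies fall below their bounds, since the transient must drop
below 1 / (k + 1) for each k. Finitely many k suffice for being η-close to the set, by
`exists_mem_tailSet_dist_le`. -/
theorem uniformlyAttracts_absorbingSet (hν : 0 ≤ ν) (hlam : 0 < lam)
    (hLip : ∀ s : Set ℝ, Bornology.IsBounded s → ∃ L : ℝ≥0, LipschitzOnWith L F s)
    (hFs : ∀ s : ℝ, F s * s ≤ 0) {f : C(ℝ, EllTwo)} {C : ℝ} (hC : 0 ≤ C) (hf : ∀ t, ‖f t‖ ≤ C)
    {B : ℕ → ℝ} (hB : Tendsto B atTop (𝓝 0)) (hB0 : ∀ k, 0 ≤ B k)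
    (hfB : ∀ k t, tailEnergy k (f t) ≤ B k) {φ : Cocycle (hullFlow f) EllTwo}
    (hφ : φ.IsGeneratedBy (IsSolution (latticeField ν lam hF (Equiv.addRight 1)))) :
    φ.UniformlyAttracts (absorbingSet ν lam C B) := by
  refine Cocycle.uniformlyAttracts_of_dist_le fun ρ η hη => ?_
  set e : ℕ → ℝ := fun k => tailBound ν lam C B k + 1 / ((k : ℝ) + 1) with he
  have he0 : ∀ k, 0 ≤ e k := fun k => by
    have := tailBound_nonneg hν hlam C hB0 k
    simp only [he]
    positivity
  have hetend : Tendsto e atTop (𝓝 0) := by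
    simpa [he] using (tendsto_tailBound ν lam C hB).add
      (tendsto_one_div_add_atTop_nhds_zero_nat (𝕜 := ℝ))
  obtain ⟨j, hj⟩ := ((tendsto_order.1 hetend).2 (η ^ 2) (by positivity)).exists
  set m := 2 * (j + 1) with hm
  obtain ⟨T, hT⟩ := exists_exp_mul_le hlam (ρ ^ 2) one_pos
  obtain ⟨τ, hτ⟩ := exists_exp_mul_le hlam ((C / lam + 1) ^ 2)
    (ε := 1 / ((m : ℝ) + 1)) (by positivity)
  refine ⟨T + τ, fun t ht y v hv => ?_⟩
  have hu := (hφ y v fun t => φ.toFun t.toNNReal v y).2 fun t => by simp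
  have hgC : ∀ t, ‖y.1 t‖ ≤ C := fun t => mem_closedBall_zero_iff.1
    (mem_of_mem_hull isClosed_closedBall (fun t => mem_closedBall_zero_iff.2 (hf t)) y.2 t)
  have hgB : ∀ k t, tailEnergy k (y.1 t) ≤ B k := fun k t =>
    mem_of_mem_hull (S := {x | tailEnergy k x ≤ B k})
      (isClosed_le continuous_energy continuous_const) (hfB k) y.2 t
  have htT : (T : ℝ) + τ ≤ t := by exact_mod_cast ht
  obtain ⟨h1, h2⟩ := hu.norm_le_and_tailEnergy_le hν hlam hLip hFs
    (fun i => (abs_abs_sub_abs_le_abs_sub _ _).trans (by simp)) hC hgC hgB hv T.coe_nonneg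
    (τ := t - T) (by linarith [τ.coe_nonneg]) hT
  simp only [add_sub_cancel, Real.toNNReal_coe] at h1 h2
  obtain ⟨k, hk, hd⟩ := exists_mem_tailSet_dist_le he0 hm.ge h1 fun k hk => by
    refine (h2 k).trans ?_
    have h3 := hτ (t - T) (by linarith)
    have h4 : 1 / ((m : ℝ) + 1) ≤ 1 / ((k : ℝ) + 1) := by
      have : (k : ℝ) ≤ m := by exact_mod_cast hk.le
      gcongr
    simp only [he]
    linarith
  exact ⟨k, hk, abs_le_of_sq_le_sq' (hd.trans hj.le) hη.le |>.2⟩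

/-- In a proper space the closed absorbing ball is itself a compact attracting set, so no tail
estimate is needed. -/
theorem exists_attractor_of_dissipative {E : Type*} [NormedAddCommGroup E]
    [InnerProductSpace ℝ E] [ProperSpace E] {N : E → E} (hN : Dissipative N lam)
    (hlam : 0 < lam) {f : C(ℝ, E)} (hfL : IsLagrangeStable f) {C : ℝ} (hC : 0 ≤ C)
    (hf : ∀ t, ‖f t‖ ≤ C) {φ : Cocycle (hullFlow f) E} (hφ : φ.IsGeneratedBy (IsSolution N)) :
    ∃ I, φ.IsCompactGlobalAttractor I := by
  have : CompactSpace (hull f) := isCompact_iff_compactSpace.1 hfL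
  have hCl : 0 ≤ C / lam := by positivity
  refine ⟨_, Cocycle.isCompactGlobalAttractor_pullbackOmega
    (isCompact_closedBall (0 : E) (C / lam + 1)) ⟨0, mem_closedBall_self (by positivity)⟩
    (Cocycle.uniformlyAttracts_of_dist_le fun ρ η hη => ?_)⟩
  obtain ⟨T, hT⟩ := exists_exp_mul_le hlam (ρ ^ 2) one_pos
  refine ⟨T, fun t ht y v hv => ?_⟩
  have hu := (hφ y v fun t => φ.toFun t.toNNReal v y).2 fun t => by simp
  have hgC : ∀ t, ‖y.1 t‖ ≤ C := fun t => mem_closedBall_zero_iff.1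
    (mem_of_mem_hull isClosed_closedBall (fun t => mem_closedBall_zero_iff.2 (hf t)) y.2 t)
  have h := hu.norm_le_of_exp_mul_le hN hlam hC hgC hv t.coe_nonneg (hT t (by exact_mod_cast ht))
  simp only [Real.toNNReal_coe] at h
  exact ⟨_, mem_closedBall_zero_iff.2 h, by simpa using hη.le⟩

/-! ### Convergence of the finite-dimensional systems -/

/-- The attractors of the finite-dimensional systems lie in one compact subset of `ℓ₂`. -/
theorem embed_mem_absorbingSet (hν : 0 ≤ ν) (hlam : 0 < lam)
    (hLip : ∀ s : Set ℝ, Bornology.IsBounded s → ∃ L : ℝ≥0, LipschitzOnWith L F s)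
    (hF0 : F 0 = 0) (hFs : ∀ s : ℝ, F s * s ≤ 0) {f : C(ℝ, EllTwo)} {C : ℝ} (hC : 0 ≤ C)
    (hf : ∀ t, ‖f t‖ ≤ C) {B : ℕ → ℝ} (hfB : ∀ k t, tailEnergy k (f t) ≤ B k) {n : ℕ}
    {idx : Fin (2 * n + 1) → ℤ} (hidx : IsSampling n idx)
    {φ : Cocycle (hullFlow (approxForcing n idx f)) (Space n)}
    (hφ : φ.IsGeneratedBy (IsSolution (periodicField ν lam F n)))
    {I : hull (approxForcing n idx f) → Set (Space n)} (hI : φ.IsCompactGlobalAttractor I)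
    {y : hull (approxForcing n idx f)} {v : Space n} (hv : v ∈ I y) :
    embed n v ∈ absorbingSet ν lam C B := by
  obtain ⟨ρ, hρ⟩ := hI.precompact.isBounded.exists_norm_le
  obtain ⟨T, hT⟩ := exists_exp_mul_le hlam (ρ ^ 2) one_pos
  have hfn : ∀ t, approxForcing n idx f t ∈ closedBall 0 C := fun t =>
    mem_closedBall_zero_iff.2 ((norm_sample_le hidx (f t)).trans (hf t))
  have hfnB : ∀ k t, approxForcing n idx f t ∈ {x | tailEnergy k (embed n x) ≤ B k} := fun k t =>
    (energy_embed_sample_le hidx (fun _ _ h => tailWeight_mono k h) (f t)).trans (hfB k t)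
  have hcont : ∀ k, Continuous fun x : Space n => tailEnergy k (embed n x) := fun k =>
    (continuous_energy (hθ := tailWeight_mem k)).comp (embedIsometry n).continuous
  have hcl : ∀ k, IsClosed {x : Space n | tailEnergy k (embed n x) ≤ B k} := fun k =>
    isClosed_le (hcont k) continuous_const
  -- By invariance a point of the attractor has an arbitrarily long past inside a bounded set. The
  -- time T spent reaching the ball depends on n through ρ, but the resulting bounds do not, and τ
  -- is free to grow.
  have key : ∀ τ : ℝ≥0, ‖embed n v‖ ≤ C / lam + 1 ∧ ∀ k, tailEnergy k (embed n v) ≤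
      Real.exp (-lam * τ) * (C / lam + 1) ^ 2 + tailBound ν lam C B k := by
    intro τ
    obtain ⟨z, hz, hzv⟩ := hI.mem_image hv (T + τ)
    generalize hullFlow (approxForcing n idx f) (-((T + τ : ℝ≥0) : ℝ)) y = y' at hz hzv
    have hu := (hφ y' z fun t => φ.toFun t.toNNReal z y').2 fun t => by simp
    have hgC : ∀ t, ‖embed n (y'.1 t)‖ ≤ C := fun t => by
      rw [← embedIsometry_apply, LinearIsometry.norm_map]
      exact mem_closedBall_zero_iff.1 (mem_of_mem_hull isClosed_closedBall hfn y'.2 t)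
    have hgB : ∀ k t, tailEnergy k (embed n (y'.1 t)) ≤ B k := fun k t =>
      mem_of_mem_hull (hcl k) (hfnB k) y'.2 t
    have hzρ : ‖embed n z‖ ≤ ρ := by
      rw [← embedIsometry_apply, LinearIsometry.norm_map]
      exact hρ z (subset_closure (mem_iUnion_of_mem _ hz))
    have hw := hu.embed (hF := memlp_comp hLip hF0) hF0
    set G : C(ℝ, EllTwo) := ⟨fun t => embed n (y'.1 t), _⟩
    have h := hw.norm_le_and_tailEnergy_le hν hlam hLip hFs
      (abs_cyclicShift_sub_le n) hC (g := G) hgC hgB hzρ T.coe_nonneg τ.coe_nonneg hT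
    have h1 : φ.toFun ((T : ℝ) + τ).toNNReal z y' = v := by
      rw [← NNReal.coe_add, Real.toNNReal_coe]
      exact hzv
    rwa [← h1]
  refine ⟨(key 0).1, fun k => ?_⟩
  obtain ⟨τ, hτ⟩ := exists_exp_mul_le hlam ((C / lam + 1) ^ 2) (ε := 1 / ((k : ℝ) + 1))
    (by positivity)
  have h1 := (key τ).2 k
  have h2 := hτ τ le_rfl
  linarith

/-- The roles are reversed: the limit u is treated as an approximate solution of the n-th embedded
system. Its defect is controlled by the tails of u on [0, t] and of the forcing, both uniformly
small because these values lie in compact sets independent of n. -/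
theorem tendsto_embed_solution (hν : 0 ≤ ν) (hlam : 0 < lam)
    (hLip : ∀ s : Set ℝ, Bornology.IsBounded s → ∃ L : ℝ≥0, LipschitzOnWith L F s)
    (hF0 : F 0 = 0) (hFs : ∀ s : ℝ, F s * s ≤ 0) {l : Filter ℕ} (hl : l ≤ atTop)
    {idx : ∀ n : ℕ, Fin (2 * n + 1) → ℤ} (hidx : ∀ n, IsSampling n (idx n))
    {S : Set EllTwo} (hS : IsCompact S) {g : C(ℝ, EllTwo)} (hgS : ∀ t, g t ∈ S)
    {gn : ∀ n, C(ℝ, Space n)} (hgn : ∀ n t, gn n t = sample n (idx n) (g t))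
    {z : EllTwo} {zn : ∀ n, Space n} (hz : Tendsto (fun n => embed n (zn n)) l (𝓝 z))
    {u : ℝ → EllTwo} (hu : IsSolution (latticeField ν lam hF (Equiv.addRight 1)) g z u)
    {un : ∀ n, ℝ → Space n} (hun : ∀ n, IsSolution (periodicField ν lam F n) (gn n) (zn n) (un n))
    {t : ℝ} (ht : 0 ≤ t) : Tendsto (fun n => embed n (un n t)) l (𝓝 (u t)) := by
  obtain ⟨C, hC⟩ := hS.isBounded.exists_norm_le
  have hC0 : 0 ≤ C := (norm_nonneg _).trans (hC _ (hgS 0))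
  set R := ‖z‖ + 1 + C / lam with hR
  obtain ⟨L, hL⟩ := exists_lipschitzOnWith_latticeField (ν := ν) (lam := lam) (hF := hF) hLip R
  have hu' := hu.hasDerivWithinAt_Icc t
  have hcomp : IsCompact (u '' Icc 0 t) :=
    isCompact_Icc.image_of_continuousOn fun s hs => (hu' s hs).continuousWithinAt
  have huR : ∀ s ∈ Icc 0 t, ‖u s‖ ≤ R := fun s hs =>
    (hu.norm_le (dissipative_latticeField hν hLip hFs _) hlam hC0 (fun t => hC _ (hgS t))
      hs.1).trans (by linarith)
  set A := Real.exp ((L + 1) * t) with hA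
  have hA0 : 0 < A := Real.exp_pos _
  rw [Metric.tendsto_nhds]
  intro η hη
  -- The budget: ε for the initial data, 4 ν ε for the neighbours changed by the cyclic shift, 2 ε
  -- for the sampled forcing; times the Grönwall factor A this is η / 2.
  set ε := η / (2 * A) / (4 * ν + 3) with hε
  have hε0 : 0 < ε := by positivity
  obtain ⟨m₁, hm₁⟩ := exists_forall_norm_sub_trunc_le hcomp hε0
  obtain ⟨m₂, hm₂⟩ := exists_forall_norm_sub_trunc_le hS hε0
  filter_upwards [hl (eventually_ge_atTop m₁), hl (eventually_ge_atTop m₂),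
    Metric.tendsto_nhds.1 hz 1 one_pos, Metric.tendsto_nhds.1 hz ε hε0] with n hn₁ hn₂ hz₁ hz₂
  have hw := (hun n).embed (hF := hF) hF0
  have hzn : ‖zn n‖ ≤ ‖z‖ + 1 := by
    have h := norm_le_norm_add_norm_sub' (embed n (zn n)) z
    rw [← (embedIsometry n).norm_map, embedIsometry_apply]
    rw [dist_eq_norm] at hz₁
    linarith
  have hwR : ∀ s ∈ Icc 0 t, ‖embed n (un n s)‖ ≤ R := fun s hs => by
    rw [← embedIsometry_apply, LinearIsometry.norm_map]
    refine ((hun n).norm_le (dissipative_periodicField hν hLip hF0 hFs n) hlam hC0 (fun t => ?_)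
      hs.1).trans (by linarith)
    rw [hgn]
    exact (norm_sample_le (hidx n) _).trans (hC _ (hgS t))
  have h := dist_le_of_approx_solution (hL (cyclicShift n)) (ε := (4 * ν + 2) * ε) (by positivity)
    (hw.hasDerivWithinAt_Icc t) hwR hu' huR (fun s hs => ?_) t ⟨ht, le_rfl⟩
  · have h0 : dist (embed n (un n 0)) (u 0) ≤ ε := by
      rw [(hun n).1, hu.1]
      exact hz₂.le
    have h1 : (dist (embed n (un n 0)) (u 0) + (4 * ν + 2) * ε) * A ≤ ((4 * ν + 3) * ε) * A := by
      gcongr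
      linarith
    have h2 : ((4 * ν + 3) * ε) * A = η / 2 := by
      rw [hε]
      field_simp
    linarith
  · refine (dist_add_add_le _ _ _ _).trans ?_
    have h1 := dist_latticeField_cyclicShift_le (lam := lam) (hF := hF) hν n (u s)
    have h2 := dist_embed_sample_le (hidx n) (g s)
    have h3 := mul_le_mul_of_nonneg_left (hm₁ n hn₁ _ (mem_image_of_mem u hs))
      (by positivity : 0 ≤ 4 * ν)
    have h4 := hm₂ n hn₂ _ (hgS s)
    rw [dist_comm] at h2
    simp only [ContinuousMap.coe_mk, hgn]
    linarith

end Lattice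

/-- Upper semicontinuity by contradiction: points of the finite attractors staying ε-far from the
limit attractor would have a limit point, and that point lies in the attractor. -/
theorem tendsto_semiDist_attractor {ν lam : ℝ} (hν : 0 ≤ ν) (hlam : 0 < lam) {F : ℝ → ℝ}
    (hLip : ∀ s : Set ℝ, Bornology.IsBounded s → ∃ L : ℝ≥0, LipschitzOnWith L F s)
    (hF0 : F 0 = 0) (hFs : ∀ s : ℝ, F s * s ≤ 0) {hF : ∀ x : EllTwo, Memℓp (fun i => F (x i)) 2}
    {f : C(ℝ, EllTwo)} (hf : IsLagrangeStable f) {idx : ∀ n : ℕ, Fin (2 * n + 1) → ℤ}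
    (hidx : ∀ n, IsSampling n (idx n)) {φ : Cocycle (hullFlow f) EllTwo}
    (hφ : φ.IsGeneratedBy (IsSolution (latticeField ν lam hF (Equiv.addRight 1))))
    {φn : ∀ n : ℕ, Cocycle (hullFlow (approxForcing n (idx n) f)) (Space n)}
    (hφn : ∀ n, (φn n).IsGeneratedBy (IsSolution (periodicField ν lam F n)))
    {I : hull f → Set EllTwo} (hI : φ.IsCompactGlobalAttractor I)
    {In : ∀ n : ℕ, hull (approxForcing n (idx n) f) → Set (Space n)}
    (hIn : ∀ n, (φn n).IsCompactGlobalAttractor (In n)) :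
    Tendsto (fun n : ℕ =>
      semiDist (embed n '' In n (hullPoint (approxForcing n (idx n) f))) (I (hullPoint f)))
      atTop (𝓝 0) := by
  obtain ⟨S, hS, hfS⟩ := exists_isCompact_forall_apply_mem hf
  obtain ⟨C, hC⟩ := hS.isBounded.exists_norm_le
  have hfC : ∀ t, ‖f t‖ ≤ C := fun t => hC _ (hfS t)
  have hC0 : 0 ≤ C := (norm_nonneg _).trans (hfC 0)
  obtain ⟨B, hB, hSB⟩ := exists_tailEnergy_bound hS
  have hfB : ∀ k t, tailEnergy k (f t) ≤ B k := fun k t => (hSB k).2 _ (hfS t)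
  have hK := isCompact_absorbingSet ν lam C hB
  have hmem : ∀ n (y : hull (approxForcing n (idx n) f)), ∀ v ∈ In n y,
      embed n v ∈ absorbingSet ν lam C B := fun n y v hv =>
    embed_mem_absorbingSet hν hlam hLip hF0 hFs hC0 hfC hfB (hidx n) (hφn n) (hIn n) hv
  rw [ENNReal.tendsto_nhds_zero]
  by_contra! hcon
  obtain ⟨ε, hε, hcon⟩ := hcon
  -- A point is selected for every n, arbitrary when n is not a bad index, so that the ultrafilter
  -- can be chosen afterwards on the bad indices.
  have hex : ∀ n : ℕ, ∃ x ∈ In n (hullPoint (approxForcing n (idx n) f)),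
      ε < semiDist (embed n '' In n (hullPoint (approxForcing n (idx n) f))) (I (hullPoint f)) →
        ε < infEDist (embed n x) (I (hullPoint f)) := fun n => by
    by_cases h : ε <
      semiDist (embed n '' In n (hullPoint (approxForcing n (idx n) f))) (I (hullPoint f))
    · obtain ⟨_, h1⟩ := lt_iSup_iff.1 h
      obtain ⟨⟨x, hx, rfl⟩, h1⟩ := lt_iSup_iff.1 h1
      exact ⟨x, hx, fun _ => h1⟩
    · obtain ⟨x, hx⟩ := (hIn n).nonempty (hullPoint (approxForcing n (idx n) f))
      exact ⟨x, hx, fun h' => absurd h' h⟩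
  choose x hx hxε using hex
  obtain ⟨𝒰, h𝒰⟩ := exists_ultrafilter_iff.2 (frequently_iff_neBot.1 hcon)
  have hε𝒰 : ∀ᶠ n in (𝒰 : Filter ℕ), ε <
      semiDist (embed n '' In n (hullPoint (approxForcing n (idx n) f))) (I (hullPoint f)) :=
    le_principal_iff.1 (h𝒰.trans inf_le_right)
  replace h𝒰 := h𝒰.trans inf_le_left
  obtain ⟨p, -, hp⟩ := hK.ultrafilter_le_nhds (𝒰.map fun n => embed n (x n))
    (le_principal_iff.2 (Eventually.of_forall fun n => hmem n _ _ (hx n) :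
      ∀ᶠ n in (𝒰 : Filter ℕ), embed n (x n) ∈ absorbingSet ν lam C B))
  have hp : Tendsto (fun n => embed n (x n)) 𝒰 (𝓝 p) := hp
  have hpI : p ∈ I (hullPoint f) := by
    -- The set K' defining I is arbitrary and need not be `absorbingSet`, hence the membership
    -- criterion with a second compact set.
    obtain ⟨K', hne, hK'c, hK', hI'⟩ := hI.levinson
    rw [hI']
    refine Cocycle.mem_pullbackOmega_of_forall_mem_image hK'c hne hK' hK fun s => ?_
    choose z hz hzx using fun n => (hIn n).mem_image (hx n) s
    obtain ⟨q, hq, hzq⟩ := hK.ultrafilter_le_nhds (𝒰.map fun n => embed n (z n))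
      (le_principal_iff.2 (Eventually.of_forall fun n => hmem n _ _ (hz n) :
        ∀ᶠ n in (𝒰 : Filter ℕ), embed n (z n) ∈ absorbingSet ν lam C B))
    have hzq : Tendsto (fun n => embed n (z n)) 𝒰 (𝓝 q) := hzq
    refine ⟨q, hq, ?_⟩
    set y := hullFlow f (-(s : ℝ)) (hullPoint f) with hy
    have hu := (hφ y q fun t => φ.toFun t.toNNReal q y).2 fun t => by simp
    have hun := fun n => (hφn n
      (hullFlow (approxForcing n (idx n) f) (-(s : ℝ)) (hullPoint (approxForcing n (idx n) f)))
      (z n) fun t => (φn n).toFun t.toNNReal (z n) (hullFlow (approxForcing n (idx n) f) (-(s : ℝ))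
        (hullPoint (approxForcing n (idx n) f)))).2 fun t => by simp
    -- Both systems start at time -s with forcings shifted by -s; sampling commutes with the shift
    -- definitionally.
    have h := tendsto_embed_solution hν hlam hLip hF0 hFs h𝒰 hidx hS
      (fun t => hfS (t + -(s : ℝ))) (fun n t => rfl) hzq hu hun s.coe_nonneg
    simp only [Real.toNNReal_coe] at h
    refine tendsto_nhds_unique h (hp.congr fun n => ?_)
    exact congrArg _ (hzx n).symm
  have h0 := ((continuous_infEDist (s := I (hullPoint f))).tendsto p).comp hp
  rw [infEDist_zero_of_mem hpI] at h0
  have h1 := ge_of_tendsto h0 (hε𝒰.mono fun n hn => (hxε n hn).le)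
  exact absurd h1 (not_le.2 hε)

end LatticeAttractor

/-! ### Assembly of the theorem. -/

open LatticeAttractor
theorem mainTheorem1 (ν lam : ℝ) (hν : 0 < ν) (hlam : 0 < lam) (F : ℝ → ℝ)
    (hLip : ∀ s : Set ℝ, Bornology.IsBounded s → ∃ L : ℝ≥0, LipschitzOnWith L F s)
    (hF0 : F 0 = 0)
    (hF : ∀ s : ℝ, F s * s ≤ 0)
    (f : C(ℝ, EllTwo)) (hf : IsLagrangeStable f)
    (idx : ∀ n : ℕ, Fin (2 * n + 1) → ℤ) (hidx : idx = site ∨ idx = swappedSite) :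
    ∃ (φ : Cocycle (hullFlow f) EllTwo)
      (φn : ∀ n : ℕ, Cocycle (hullFlow (approxForcing n (idx n) f)) (Space n)),
      φ.IsGeneratedBy (IsLatticeSolution ν lam F) ∧
      (∀ n, (φn n).IsGeneratedBy (IsApproxSolution ν lam F n)) ∧
      (∃ I, φ.IsCompactGlobalAttractor I) ∧
      (∀ n, ∃ I, (φn n).IsCompactGlobalAttractor I) ∧
      ∀ (I : hull f → Set EllTwo) (In : ∀ n : ℕ, hull (approxForcing n (idx n) f) → Set (Space n)),
        φ.IsCompactGlobalAttractor I →
        (∀ n, (φn n).IsCompactGlobalAttractor (In n)) →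
        Tendsto
          (fun n : ℕ =>
            semiDist (embed n '' In n (hullPoint (approxForcing n (idx n) f))) (I (hullPoint f)))
          atTop (𝓝 0) := by
  have hidx' : ∀ n, IsSampling n (idx n) := fun n => by
    rcases hidx with rfl | rfl
    · exact isSampling_site n
    · exact isSampling_swappedSite n
  have hm := memlp_comp hLip hF0
  obtain ⟨S, hS, hfS⟩ := exists_isCompact_forall_apply_mem hf
  obtain ⟨C, hC⟩ := hS.isBounded.exists_norm_le
  have hfC : ∀ t, ‖f t‖ ≤ C := fun t => hC _ (hfS t)
  have hC0 : 0 ≤ C := (norm_nonneg _).trans (hfC 0)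
  obtain ⟨B, hB, hSB⟩ := exists_tailEnergy_bound hS
  have hfnC : ∀ n t, ‖approxForcing n (idx n) f t‖ ≤ C := fun n t =>
    (norm_sample_le (hidx' n) (f t)).trans (hfC t)
  have hN := dissipative_latticeField (lam := lam) (hF := hm) hν.le hLip hF (Equiv.addRight 1)
  have hNn := dissipative_periodicField (lam := lam) hν.le hLip hF0 hF
  obtain ⟨φ, hφ⟩ := exists_cocycle hN hlam f hfC
  choose φn hφn using fun n => exists_cocycle (hNn n) hlam (approxForcing n (idx n) f) (hfnC n)
  have : CompactSpace (hull f) := isCompact_iff_compactSpace.1 hf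
  refine ⟨φ, φn, fun g v u => isLatticeSolution_iff.trans (hφ g v u),
    fun n g v u => isApproxSolution_iff.trans (hφn n g v u),
    ⟨_, Cocycle.isCompactGlobalAttractor_pullbackOmega (isCompact_absorbingSet ν lam C hB)
      ⟨0, zero_mem_absorbingSet hν.le hlam hC0 fun k => (hSB k).1⟩
      (uniformlyAttracts_absorbingSet hν.le hlam hLip hF hC0 hfC hB (fun k => (hSB k).1)
        (fun k t => (hSB k).2 _ (hfS t)) hφ)⟩,
    fun n => exists_attractor_of_dissipative (hNn n) hlam
      (isLagrangeStable_approxForcing n (idx n) hf) hC0 (hfnC n) (hφn n),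
    fun I In hI hIn =>
      tendsto_semiDist_attractor hν.le hlam hLip hF0 hF hf hidx' hφ hφn hI hIn⟩
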